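/- Let $d\ge 1$, let $r=(r_1,\dots,r_d)$ be a vector of nonnegative integers and let $k$ be an integer with $r_{i+1}\ge 2r_i$ for $1\le i\le d-1$ and $k\ge 2r_d+1$. Notation. For integers $s,\kappa\ge 0$ and $q=(q_1,\dots,q_s)$ let $\Sigma_0^{(q)}(s,\kappa)$ be the set of $(\beta_0,\dots,\beta_s)\in\mathbb{Z}_{\ge 0}^{s+1}$ with $\beta_0+\dots+\beta_s=\kappa$ such that, for $t=1,\dots,s$, the sum of any $t$ of the entries is $>q_t$. For a simplex $\sigma$ of dimension $s$ with barycentric coordinates $\lambda_0,\dots,\lambda_s$ put $\Lambda\Sigma_0^{(q)}(s,\kappa)=\operatorname{span}\{\lambda_0^{\beta_0}\cdots\lambda_s^{\beta_s}:\beta\in\Sigma_0^{(q)}(s,\kappa)\}$. For each simplex $\sigma\subset\mathbb{R}^d$ of codimension $m$ ($0\le m\le d$) fix $m$ linearly independent unit vectors $n_1,\dots,n_m$ normal to $\sigma$. The degrees of freedom on $\sigma$ are $$u\longmapsto \frac{1}{|\sigma|}\int_\sigma \frac{\partial^{|\theta|}u}{\partial n_1^{\theta_1}\cdots\partial n_m^{\theta_m}}\;p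 ,\qquad p\in\Lambda\Sigma_0^{(q)}(d-m,k-|\theta|),\quad q_t=r_{t+m}-|\theta|\ (1\le t\le d-m),$$ for all $\theta\in\mathbb{Z}_{\ge0}^m$ with $|\theta|=\theta_1+\dots+\theta_m\le r_m$ (for $m=0$ only the empty $\theta$, with $|\theta|=0$; if $\sigma$ is a vertex the mean over $\sigma$ is the value at that vertex). Theorem. (1) Let $K\subset\mathbb{R}^d$ be a nondegenerate $d$-simplex. The degrees of freedom on all the subsimplices of $K$ (of dimension $0,\dots,d$) are unisolvent for the space $P_k(K)$ of polynomials of degree $\le k$: those tested against the monomials $p=\prod_i\lambda_i^{\beta_i}$, $\beta\in\Sigma_0^{(q)}(d-m,k-|\theta|)$, take any prescribed real values on exactly one $u\in P_k(K)$; equivalently, exactly one $u\in P_k(K)$ has degrees of freedom prescribed for all $p$ in the test spaces, the values depending linearly on $p$. (2) Let $\Omega\subset\mathbb{R}^d$ be open and let $\mathcal{T}$ be a finite conforming $d$-dimensional simplicial mesh whose simplices have union $\overline\Omega$. Let $f\in C(\Omega)$ be such that on each element $K\in\mathcal{T}$ it is given by a polynomial $u_K\in P_k(K)$, and such that for each subsimplex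 $\sigma$ of dimension $\le d-1$ each degree of freedom on $\sigma$ takes the same value at $u_K$ for all elements $K$ that contain $\sigma$. Then $f\in C^{r_1}(\Omega)$; moreover all derivatives of $f$ of order $\le r_1$ extend continuously to $\overline\Omega$. (3) In particular, for every integer $\rho\ge0$ and every $k\ge 2^d\rho+1$, the choice $r_i=2^{i-1}\rho$ gives a $C^\rho$ conforming finite element with shape functions $P_k$: (1) holds, and (2) holds with $C^{\rho}$ in place of $C^{r_1}$. -/

import Mathlib

open MeasureTheory

namespace SmoothFE

/-- The ambient space `ℝ^d` with its Euclidean structure. -/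
abbrev Space (d : ℕ) : Type := EuclideanSpace ℝ (Fin d)

/-! ### The condition on the orders and on the degree -/

/-- `r_{i+1} ≥ 2 r_i` for `1 ≤ i < d`, and `k ≥ 2 r_d + 1`. A vector `(r_1, …, r_d)` is coded by a
function on `ℕ`, of which only the values at `1, …, d` matter. -/
def Admissible (d : ℕ) (r : ℕ → ℕ) (k : ℕ) : Prop :=
  (∀ i, 1 ≤ i → i < d → 2 * r i ≤ r (i + 1)) ∧ 2 * r d + 1 ≤ k

/-! ### Multi-indices -/

/-- `Σ₀^{(q)}(s, κ)`, with the `s + 1` positions indexed by `ι`: the multi-indices `β` with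
`|β| = κ` such that the sum of any `t` entries is larger than `q_t`, for `t = 1, …, s`
(the sets of positions of these sizes are the nonempty proper ones). -/
def Sigma0 (ι : Type) [Fintype ι] (q : ℕ → ℕ) (κ : ℕ) : Set (ι → ℕ) :=
  {β | ∑ i, β i = κ ∧
    ∀ s : Finset ι, s.Nonempty → s ≠ Finset.univ → q s.card < ∑ i ∈ s, β i}

/-! ### Polynomials, simplices and barycentric coordinates -/

section
variable {d : ℕ}

/-- The linear map from polynomials in `d` variables to functions on `ℝ^d`. -/
noncomputable def polyFun (d : ℕ) : MvPolynomial (Fin d) ℝ →ₗ[ℝ] (Space d → ℝ) :=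
  LinearMap.pi fun x => (MvPolynomial.aeval (fun i => x i)).toLinearMap

/-- `P_k`: the polynomial functions of total degree at most `k`. A polynomial on a nondegenerate
simplex `K` is identified with its unique polynomial extension to `ℝ^d`, so that this is also
`P_k(K)`. -/
noncomputable def polySpace (d k : ℕ) : Submodule ℝ (Space d → ℝ) :=
  (MvPolynomial.restrictTotalDegree (Fin d) ℝ k).map (polyFun d)

/-- `V` is the set of vertices of a nondegenerate `d`-simplex of `ℝ^d`. A simplex is given by its
set of vertices, its subsimplices are the nonempty subsets `σ ⊆ V`, and the point set of `σ` is
`convexHull ℝ σ`. -/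
def IsTopSimplex (V : Finset (Space d)) : Prop :=
  V.card = d + 1 ∧ AffineIndependent ℝ ((↑) : V → Space d)

/-- The codimension in `ℝ^d` of a simplex `σ`, which has dimension `σ.card - 1`. -/
def codim (σ : Finset (Space d)) : ℕ := d + 1 - σ.card

open Classical in
/-- The barycentric coordinate of `x` associated to the vertex `v` of the simplex `σ`: the
coefficient at `v` of the (unique) affine combination of the vertices that is equal to `x`.
Only used for `x` in the affine span of `σ` (elsewhere it is zero). -/
noncomputable def bary (σ : Finset (Space d)) (v : σ) (x : Space d) : ℝ :=
  if h : ∃ w : σ → ℝ, ∑ y, w y = 1 ∧ ∑ y, w y • (y : Space d) = x then h.choose v else 0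

/-- The barycentric monomial `∏ λ_v ^ β_v` of the simplex `σ`. -/
noncomputable def baryMonomial (σ : Finset (Space d)) (β : σ → ℕ) (x : Space d) : ℝ :=
  ∏ v, bary σ v x ^ β v

/-! ### The degrees of freedom -/

/-- `n` consists of `codim σ` linearly independent unit vectors normal to `σ`. -/
def IsNormalFrame (σ : Finset (Space d)) (n : Fin (codim σ) → Space d) : Prop :=
  (∀ i, ‖n i‖ = 1) ∧ LinearIndependent ℝ n ∧
    ∀ i, ∀ v ∈ vectorSpan ℝ (σ : Set (Space d)), inner ℝ (n i) v = 0

/-- The directional derivative `∂u/∂v`. -/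
noncomputable def dirDeriv (v : Space d) (u : Space d → ℝ) : Space d → ℝ :=
  fun x => lineDeriv ℝ u x v

/-- `∂^{|θ|} u / ∂n_1^{θ_1} ⋯ ∂n_m^{θ_m}`. -/
noncomputable def iterDirDeriv {m : ℕ} (n : Fin m → Space d) (θ : Fin m → ℕ)
    (u : Space d → ℝ) : Space d → ℝ :=
  (List.ofFn fun i => (dirDeriv (n i))^[θ i]).foldr (fun D g => D g) u

/-- The degree of freedom `(1/|σ|) ⟨∂^{|θ|} u / ∂n^θ, p⟩_σ`: the mean over `σ` with respect to the
Euclidean measure of dimension `dim σ` (a point evaluation if `σ` is a vertex). -/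
noncomputable def dof (σ : Finset (Space d)) (n : Fin (codim σ) → Space d)
    (θ : Fin (codim σ) → ℕ) (p u : Space d → ℝ) : ℝ :=
  ⨍ x in convexHull ℝ (σ : Set (Space d)), iterDirDeriv n θ u x * p x ∂μHE[σ.card - 1]

/-- The multi-indices `Σ₀^{(q)}(d - m, k - |θ|)` on `σ`, where `m = codim σ` and
`q_t = r_{t+m} - |θ|`. For admissible `r`, `k` and `|θ| ≤ r_m` no subtraction is truncated. -/
def testIndices (r : ℕ → ℕ) (k : ℕ) (σ : Finset (Space d)) (θ : Fin (codim σ) → ℕ) :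
    Set (σ → ℕ) :=
  Sigma0 σ (fun t => r (t + codim σ) - ∑ i, θ i) (k - ∑ i, θ i)

/-- The space of test functions `ΛΣ₀^{(q)}(d - m, k - |θ|)` on `σ`. -/
noncomputable def testSpace (r : ℕ → ℕ) (k : ℕ) (σ : Finset (Space d))
    (θ : Fin (codim σ) → ℕ) : Submodule ℝ (Space d → ℝ) :=
  Submodule.span ℝ (baryMonomial σ '' testIndices r k σ θ)

/-- The multi-indices `θ = (θ_1, …, θ_m)` used on `σ`: `|θ| ≤ r_m`, where `m = codim σ`
(for `m = 0` only the empty `θ`, whatever `r 0` is). -/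
def orders (r : ℕ → ℕ) (σ : Finset (Space d)) : Set (Fin (codim σ) → ℕ) :=
  {θ | ∑ i, θ i ≤ r (codim σ)}

/-- The degrees of freedom on all the subsimplices of the simplex `V` are unisolvent for
`P_k`: an element of `P_k` exists and is unique with prescribed degrees of freedom.
The first part prescribes those tested against the spanning monomials, with arbitrary real values
(so that these functionals form a basis of the dual of `P_k`). The second part prescribes
those tested against all `p` in the test spaces, with values depending linearly on `p`. -/
def Unisolvent (r : ℕ → ℕ) (k : ℕ) (V : Finset (Space d))
    (n : (σ : Finset (Space d)) → Fin (codim σ) → Space d) : Prop :=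
  (∀ c : (σ : Finset (Space d)) → (Fin (codim σ) → ℕ) → (σ → ℕ) → ℝ,
    ∃! u : Space d → ℝ, u ∈ polySpace d k ∧
      ∀ σ ⊆ V, σ.Nonempty → ∀ θ ∈ orders r σ, ∀ β ∈ testIndices r k σ θ,
        dof σ (n σ) θ (baryMonomial σ β) u = c σ θ β) ∧
  (∀ c : (σ : Finset (Space d)) → (Fin (codim σ) → ℕ) → Module.Dual ℝ (Space d → ℝ),
    ∃! u : Space d → ℝ, u ∈ polySpace d k ∧
      ∀ σ ⊆ V, σ.Nonempty → ∀ θ ∈ orders r σ, ∀ p ∈ testSpace r k σ θ,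
        dof σ (n σ) θ p u = c σ θ p)

/-! ### Meshes and the global finite element space -/

/-- `T` is a (finite, conforming) `d`-dimensional simplicial mesh of the open set `Ω`. -/
structure IsMesh (T : Geometry.SimplicialComplex ℝ (Space d)) (Ω : Set (Space d)) : Prop where
  isOpen : IsOpen Ω
  finite : T.faces.Finite
  pure : ∀ σ ∈ T.faces, ∃ K ∈ T.faces, K.card = d + 1 ∧ σ ⊆ K
  covers : T.space = closure Ω

/-- The elements of the mesh: its `d`-dimensional simplices. -/
def elements (T : Geometry.SimplicialComplex ℝ (Space d)) : Set (Finset (Space d)) :=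
  {K | K ∈ T.faces ∧ K.card = d + 1}

/-- The global finite element space: the continuous functions `f` on `Ω` which on each element `K`
are given by a polynomial `U K ∈ P_k`, such that each degree of freedom on each subsimplex of
dimension at most `d - 1` takes the same value from all the elements that contain it. -/
def feSpace (r : ℕ → ℕ) (k : ℕ) (T : Geometry.SimplicialComplex ℝ (Space d))
    (Ω : Set (Space d)) (n : (σ : Finset (Space d)) → Fin (codim σ) → Space d) :
    Set (Space d → ℝ) :=
  {f | ContinuousOn f Ω ∧ ∃ U : Finset (Space d) → Space d → ℝ,
    (∀ K ∈ elements T, U K ∈ polySpace d k ∧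
      Set.EqOn f (U K) (convexHull ℝ (K : Set (Space d)) ∩ Ω)) ∧
    ∀ K ∈ elements T, ∀ K' ∈ elements T, ∀ σ, σ ⊆ K → σ ⊆ K' → σ.Nonempty → σ.card ≤ d →
      ∀ θ ∈ orders r σ, ∀ p ∈ testSpace r k σ θ,
        dof σ (n σ) θ p (U K) = dof σ (n σ) θ p (U K')}

/-- The functions of class `C^ρ` on the open set `Ω`, up to the boundary: `C^ρ` in `Ω`, and all
the derivatives of order at most `ρ` extend continuously to the closure. -/
def smoothSpace (ρ : ℕ) (Ω : Set (Space d)) : Set (Space d → ℝ) :=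
  {f | ContDiffOn ℝ ρ f Ω ∧ ∀ j ≤ ρ, ∃ F : Space d → (Space d [×j]→L[ℝ] ℝ),
    ContinuousOn F (closure Ω) ∧ Set.EqOn F (iteratedFDeriv ℝ j f) Ω}

end

/-- The degrees of freedom for `r` and `k` define a `C^ρ` conforming finite element in dimension
`d` with shape functions `P_k`: they are unisolvent on each `d`-simplex, and on each mesh the
global space consists of functions of class `C^ρ`, for all choices of the normal vectors. -/
def IsConformingElement (d : ℕ) (r : ℕ → ℕ) (k ρ : ℕ) : Prop :=
  (∀ (V : Finset (Space d)) (n : (σ : Finset (Space d)) → Fin (codim σ) → Space d),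
    IsTopSimplex V → (∀ σ ⊆ V, σ.Nonempty → IsNormalFrame σ (n σ)) → Unisolvent r k V n) ∧
  (∀ (Ω : Set (Space d)) (T : Geometry.SimplicialComplex ℝ (Space d))
    (n : (σ : Finset (Space d)) → Fin (codim σ) → Space d),
    IsMesh T Ω → (∀ σ ∈ T.faces, IsNormalFrame σ (n σ)) →
      feSpace r k T Ω n ⊆ smoothSpace ρ Ω)

end SmoothFE

/-! In barycentric coordinates of `K`, the space P_k is the space of forms of degree k, with one
basis monomial for each multi-index of weight k on the vertices. Vanishing to order N along a face σ
becomes a condition on coefficients: no monomial has degree below N in the variables of the vertices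
opposite to σ (`vanishOrder`).

Determination (`mem_vanishOrder_of_dof_eq_zero`): if the degrees of freedom of p vanish on all
subfaces of a face F, then p vanishes to order r_m + 1 along each subface of codimension m. The
induction is on the dimension of the subface σ and, for fixed σ, on the order j. A normal derivative
q of order j is a form of degree k - j. As p already vanishes to high order along the proper faces
of σ, the monomials of q that survive on σ have their exponents in the index set of the test space.
So q restricted to σ is itself a test function, its mean square is zero, and q vanishes on σ. For σ
= F = K this gives p = 0.

Counting (`DofIndex.toIndex_injective`): a degree of freedom (σ, θ, β) is glued to a multi-index of
weight k on the vertices of K, with β on σ and θ off σ. The doubling condition on r and the bound on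
k make this injective, so there are at most dim P_k degrees of freedom. With the trivial kernel,
this gives unisolvence.

Smoothness: determination on F = K ∩ K', applied to the difference of two pieces, makes their
derivatives up to order r_1 agree on F. Piecewise Taylor series with this compatibility glue
(`mem_smoothSpace_of_piecewise`). -/

open MeasureTheory

namespace SmoothFE

/-! ### Euclidean Hausdorff measure on a simplex of any dimension. -/

section Measure
variable {d : ℕ}

/-- The isometric parametrization of the affine span of a set by the direction of the span. -/
noncomputable def spanParam (s : Set (Space d)) (p : Space d) (w : vectorSpan ℝ s) : Space d :=
  (w : Space d) + p

lemma spanParam_isometry (s : Set (Space d)) (p : Space d) : Isometry (spanParam s p) :=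
  Isometry.of_dist_eq fun x y => by simp [spanParam, dist_add_right, Subtype.dist_eq]

lemma convexHull_subset_range_spanParam {s : Set (Space d)} {p : Space d} (hp : p ∈ s) :
    convexHull ℝ s ⊆ Set.range (spanParam s p) := by
  intro x hx
  have hx' : x ∈ affineSpan ℝ s := convexHull_subset_affineSpan s hx
  have : x -ᵥ p ∈ vectorSpan ℝ s := by
    rw [← direction_affineSpan]
    exact AffineSubspace.vsub_mem_direction hx' (subset_affineSpan ℝ s hp)
  exact ⟨⟨x -ᵥ p, this⟩, by simp [spanParam]⟩

/-- In finite dimension a convex set has interior as soon as it spans affinely, and the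
parametrization turns the hull into a spanning set of the direction space. -/
lemma spanParam_preimage_interior_nonempty {s : Set (Space d)} {p : Space d} (hp : p ∈ s) :
    (interior (spanParam s p ⁻¹' convexHull ℝ s)).Nonempty := by
  let e : vectorSpan ℝ s →ᵃ[ℝ] Space d :=
    (vectorSpan ℝ s).subtype.toAffineMap + AffineMap.const ℝ _ p
  have he : (e : vectorSpan ℝ s → Space d) = spanParam s p := rfl
  have hconv : Convex ℝ (spanParam s p ⁻¹' convexHull ℝ s) := by
    rw [← he]; exact (convex_convexHull ℝ s).affine_preimage e
  rw [hconv.interior_nonempty_iff_affineSpan_eq_top]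
  have hinj : Function.Injective e := (spanParam_isometry s p).injective
  have himg : e '' (spanParam s p ⁻¹' convexHull ℝ s) = convexHull ℝ s := by
    rw [he, Set.image_preimage_eq_inter_range,
      Set.inter_eq_left.2 (convexHull_subset_range_spanParam hp)]
  rw [eq_top_iff]
  intro w _
  have h1 : e w ∈ (affineSpan ℝ (spanParam s p ⁻¹' convexHull ℝ s)).map e := by
    rw [AffineSubspace.map_span, himg, affineSpan_convexHull]
    exact AffineSubspace.vadd_mem_of_mem_direction (by rw [direction_affineSpan]; exact w.2)
      (subset_affineSpan ℝ s hp)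
  obtain ⟨w', hw', h⟩ := h1
  rwa [← hinj h]

variable {σ : Finset (Space d)}

lemma finrank_vectorSpan_of_indep (hσ : AffineIndependent ℝ ((↑) : σ → Space d))
    (hne : σ.Nonempty) : Module.finrank ℝ (vectorSpan ℝ (σ : Set (Space d))) = σ.card - 1 := by
  have h := hσ.finrank_vectorSpan (n := σ.card - 1) (by
    have := hne.card_pos
    simp; omega)
  have hr : Set.range ((↑) : σ → Space d) = (σ : Set (Space d)) := Subtype.range_coe
  rwa [hr] at h

/-- Isometries preserve Hausdorff measure. This moves the measure on σ to a space of its own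
dimension, where compact sets have finite measure and nonempty open sets positive measure. -/
lemma volume_preimage_spanParam (hσ : AffineIndependent ℝ ((↑) : σ → Space d)) (hne : σ.Nonempty)
    (p : Space d) (t : Set (Space d)) (ht : t ⊆ Set.range (spanParam (σ : Set (Space d)) p)) :
    (μHE[Module.finrank ℝ (vectorSpan ℝ (σ : Set (Space d)))] :
      Measure (vectorSpan ℝ (σ : Set (Space d)))) (spanParam (σ : Set (Space d)) p ⁻¹' t)
      = μHE[σ.card - 1] t := by
  rw [(spanParam_isometry _ p).euclideanHausdorffMeasure_preimage, Set.inter_eq_left.2 ht,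
    finrank_vectorSpan_of_indep hσ hne]

lemma isCompact_hull (σ : Finset (Space d)) : IsCompact (convexHull ℝ (σ : Set (Space d))) :=
  σ.finite_toSet.isCompact_convexHull ℝ

lemma measure_hull_ne_top (hσ : AffineIndependent ℝ ((↑) : σ → Space d)) (hne : σ.Nonempty) :
    (μHE[σ.card - 1] : Measure (Space d)) (convexHull ℝ (σ : Set (Space d))) ≠ ⊤ := by
  obtain ⟨p, hp⟩ := hne
  rw [← volume_preimage_spanParam hσ ⟨p, hp⟩ p _ (convexHull_subset_range_spanParam hp)]
  refine IsCompact.measure_ne_top ?_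
  exact ((spanParam_isometry _ p).isClosedEmbedding).isCompact_preimage (isCompact_hull σ)

lemma measure_hull_ne_zero (hσ : AffineIndependent ℝ ((↑) : σ → Space d)) (hne : σ.Nonempty) :
    (μHE[σ.card - 1] : Measure (Space d)) (convexHull ℝ (σ : Set (Space d))) ≠ 0 := by
  obtain ⟨p, hp⟩ := hne
  rw [← volume_preimage_spanParam hσ ⟨p, hp⟩ p _ (convexHull_subset_range_spanParam hp)]
  exact (Measure.measure_pos_of_nonempty_interior _
    (spanParam_preimage_interior_nonempty (Finset.mem_coe.2 hp))).ne'

lemma integrableOn_hull (hσ : AffineIndependent ℝ ((↑) : σ → Space d)) (hne : σ.Nonempty)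
    {g : Space d → ℝ} (hg : Continuous g) :
    IntegrableOn g (convexHull ℝ (σ : Set (Space d))) μHE[σ.card - 1] := by
  obtain ⟨C, hC⟩ := (isCompact_hull σ).exists_bound_of_continuousOn hg.continuousOn
  refine Measure.integrableOn_of_bounded (M := C) (measure_hull_ne_top hσ hne)
    hg.aestronglyMeasurable ?_
  exact (ae_restrict_iff' (isCompact_hull σ).measurableSet).2 (Filter.Eventually.of_forall hC)

/-- A nonnegative continuous function whose mean over a simplex vanishes is zero on it. -/
lemma eq_zero_on_hull_of_setAverage_eq_zero (hσ : AffineIndependent ℝ ((↑) : σ → Space d))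
    (hne : σ.Nonempty) {g : Space d → ℝ} (hg : Continuous g) (hpos : ∀ x, 0 ≤ g x)
    (h : ⨍ x in convexHull ℝ (σ : Set (Space d)), g x ∂μHE[σ.card - 1] = 0) :
    ∀ x ∈ convexHull ℝ (σ : Set (Space d)), g x = 0 := by
  obtain ⟨p, hp⟩ := hne
  have hne : σ.Nonempty := ⟨p, hp⟩
  set S := convexHull ℝ (σ : Set (Space d)) with hS
  have hSr := convexHull_subset_range_spanParam (Finset.mem_coe.2 hp)
  rw [setAverage_eq, smul_eq_mul, mul_eq_zero] at h
  have h0 : ∫ x in S, g x ∂μHE[σ.card - 1] = 0 := by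
    refine h.resolve_left ?_
    rw [inv_eq_zero, measureReal_def, ENNReal.toReal_eq_zero_iff, not_or]
    exact ⟨measure_hull_ne_zero hσ hne, measure_hull_ne_top hσ hne⟩
  rw [setIntegral_eq_zero_iff_of_nonneg_ae (Filter.Eventually.of_forall hpos)
    (integrableOn_hull hσ hne hg), Filter.EventuallyEq,
    ae_restrict_iff' (isCompact_hull σ).measurableSet, ae_iff] at h0
  set e := spanParam (σ : Set (Space d)) p with he
  have hec : Continuous e := (spanParam_isometry _ p).continuous
  have h1 : (μHE[Module.finrank ℝ (vectorSpan ℝ (σ : Set (Space d)))] :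
      Measure (vectorSpan ℝ (σ : Set (Space d)))) (e ⁻¹' {x | ¬ (x ∈ S → g x = 0)}) = 0 := by
    rw [volume_preimage_spanParam hσ hne]
    · exact h0
    · intro x hx
      simp only [Set.mem_ofPred_eq, not_forall] at hx
      exact hSr hx.1
  -- An open null set is empty, so g vanishes on the relative interior; the relative boundary
  -- follows because a convex set with interior lies in the closure of that interior.
  have hopen : IsOpen (interior (e ⁻¹' S) ∩ {w | g (e w) ≠ 0}) :=
    isOpen_interior.inter (isOpen_ne_fun (hg.comp hec) continuous_const)
  have h2 : interior (e ⁻¹' S) ∩ {w | g (e w) ≠ 0} = ∅ := by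
    refine hopen.eq_empty_of_measure_zero (measure_mono_null ?_ h1)
    rintro w ⟨hw1, hw2⟩
    simp only [Set.mem_preimage, Set.mem_ofPred_eq, not_forall]
    exact ⟨interior_subset (s := e ⁻¹' S) hw1, hw2⟩
  have hconv : Convex ℝ (e ⁻¹' S) :=
    (convex_convexHull ℝ (σ : Set (Space d))).affine_preimage
      ((vectorSpan ℝ (σ : Set (Space d))).subtype.toAffineMap + AffineMap.const ℝ _ p)
  have hcl : closure (interior (e ⁻¹' S)) ⊆ {w | g (e w) = 0} := by
    refine closure_minimal ?_ (isClosed_eq (hg.comp hec) continuous_const)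
    intro w hw
    by_contra hne
    exact (Set.eq_empty_iff_forall_notMem.1 h2 w) ⟨hw, hne⟩
  intro x hx
  obtain ⟨w, rfl⟩ := hSr hx
  refine hcl ?_
  rw [hconv.closure_interior_eq_closure_of_nonempty_interior
    (spanParam_preimage_interior_nonempty (Finset.mem_coe.2 hp))]
  exact subset_closure hx

end Measure

/-! ### Order of vanishing along a coordinate subspace, read on coefficients. -/

section Vanishing
variable {ι : Type*}

/-- The polynomials without monomials of degree less than `N` in the variables of `s`. -/
def vanishOrder (s : Finset ι) (N : ℕ) : Submodule ℝ (MvPolynomial ι ℝ) where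
  carrier := {p | ∀ α : ι →₀ ℕ, ∑ i ∈ s, α i < N → p.coeff α = 0}
  add_mem' hp hq α hα := by simp [hp α hα, hq α hα]
  zero_mem' := by simp
  smul_mem' c p hp α hα := by simp [hp α hα]

lemma mem_vanishOrder {s : Finset ι} {N : ℕ} {p : MvPolynomial ι ℝ} :
    p ∈ vanishOrder s N ↔ ∀ α : ι →₀ ℕ, ∑ i ∈ s, α i < N → p.coeff α = 0 := Iff.rfl

lemma vanishOrder_zero (s : Finset ι) (p : MvPolynomial ι ℝ) : p ∈ vanishOrder s 0 :=
  fun _ h => absurd h (by simp)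

lemma vanishOrder_anti {s : Finset ι} {M N : ℕ} (h : M ≤ N) : vanishOrder s N ≤ vanishOrder s M :=
  fun _ hp α hα => hp α (hα.trans_le h)

lemma sum_add_single [DecidableEq ι] (s : Finset ι) (α : ι →₀ ℕ) (i : ι) :
    ∑ j ∈ s, (α + Finsupp.single i 1 : ι →₀ ℕ) j = ∑ j ∈ s, α j + if i ∈ s then 1 else 0 := by
  simp [Finset.sum_add_distrib, Finsupp.single_apply]

lemma pderiv_mem_vanishOrder (s : Finset ι) (N : ℕ) (i : ι) {p : MvPolynomial ι ℝ}
    (hp : p ∈ vanishOrder s (N + 1)) : MvPolynomial.pderiv i p ∈ vanishOrder s N := by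
  classical
  intro α hα
  rw [MvPolynomial.coeff_pderiv, hp _ _, zero_mul]
  rw [sum_add_single]
  split_ifs <;> omega

lemma pderiv_mem_vanishOrder_of_notMem (s : Finset ι) (N : ℕ) {i : ι} (hi : i ∉ s)
    {p : MvPolynomial ι ℝ} (hp : p ∈ vanishOrder s N) :
    MvPolynomial.pderiv i p ∈ vanishOrder s N := by
  classical
  intro α hα
  rw [MvPolynomial.coeff_pderiv, hp _ _, zero_mul]
  rw [sum_add_single]
  simpa [hi] using hα

/-- A monomial of s-degree N + 1 contains some variable i of s, and its coefficient reappears in the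
i-th partial derivative multiplied by a nonzero integer, at s-degree N. -/
lemma mem_vanishOrder_succ_of_pderiv {s : Finset ι} {N : ℕ} {p : MvPolynomial ι ℝ}
    (hp : p ∈ vanishOrder s (N + 1))
    (h : ∀ i ∈ s, MvPolynomial.pderiv i p ∈ vanishOrder s (N + 1)) :
    p ∈ vanishOrder s (N + 2) := by
  classical
  intro α hα
  by_cases h0 : ∑ i ∈ s, α i < N + 1
  · exact hp α h0
  obtain ⟨i, hi, hαi⟩ : ∃ i ∈ s, α i ≠ 0 := by
    by_contra! hc
    rw [Finset.sum_eq_zero hc] at h0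
    omega
  have hsplit : α = (α - Finsupp.single i 1) + Finsupp.single i 1 := by
    ext j
    simp only [Finsupp.add_apply, Finsupp.tsub_apply, Finsupp.single_apply]
    split_ifs with hij
    · subst hij; omega
    · simp
  have hs : ∑ j ∈ s, (α - Finsupp.single i 1 : ι →₀ ℕ) j < N + 1 := by
    have := sum_add_single s (α - Finsupp.single i 1) i
    rw [← hsplit, if_pos hi] at this
    omega
  have h1 := h i hi _ hs
  rw [MvPolynomial.coeff_pderiv, ← hsplit, mul_eq_zero] at h1
  exact h1.resolve_right (by positivity)

lemma eval_smul_of_isHomogeneous {m : ℕ} {q : MvPolynomial ι ℝ} (hq : q.IsHomogeneous m) (c : ℝ)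
    (w : ι → ℝ) : MvPolynomial.eval (c • w) q = c ^ m * MvPolynomial.eval w q := by
  rw [MvPolynomial.eval_eq, MvPolynomial.eval_eq, Finset.mul_sum]
  refine Finset.sum_congr rfl fun α hα => ?_
  have hm : ∑ i ∈ α.support, α i = m := by
    have := hq (MvPolynomial.mem_support_iff.1 hα)
    simpa [Finsupp.weight_apply, Finsupp.sum] using this
  simp only [Pi.smul_apply, smul_eq_mul, mul_pow, Finset.prod_mul_distrib, Finset.prod_pow_eq_pow_sum,
    hm]
  ring

/-- Homogeneity extends the vanishing from a face of the standard simplex to the cone over it, which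
is large enough to kill every coefficient free of the variables of s. -/
lemma mem_vanishOrder_one_of_eval_eq_zero [Fintype ι] {s : Finset ι} {m : ℕ} {q : MvPolynomial ι ℝ}
    (hq : q.IsHomogeneous m) (hs : s ≠ Finset.univ)
    (h : ∀ w : ι → ℝ, (∀ i, 0 ≤ w i) → (∀ i ∈ s, w i = 0) → ∑ i, w i = 1 →
      MvPolynomial.eval w q = 0) : q ∈ vanishOrder s 1 := by
  classical
  have hcone : ∀ w : ι → ℝ, (∀ i, 0 ≤ w i) → (∀ i ∈ s, w i = 0) → 0 < ∑ i, w i →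
      MvPolynomial.eval w q = 0 := by
    intro w h0 h1 h2
    have := h ((∑ i, w i)⁻¹ • w) (fun i => by simp; exact mul_nonneg (by positivity) (h0 i))
      (fun i hi => by simp [h1 i hi]) (by simp [← Finset.mul_sum, h2.ne'])
    rw [eval_smul_of_isHomogeneous hq] at this
    exact (mul_eq_zero.1 this).resolve_left (by positivity)
  -- Setting the variables of s to zero keeps exactly the monomials of s-degree zero, so the claim
  -- becomes `ρ q = 0`.
  set ρ : MvPolynomial ι ℝ →ₐ[ℝ] MvPolynomial ι ℝ :=
    MvPolynomial.aeval (fun i => if i ∈ s then 0 else MvPolynomial.X i) with hρ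
  have hmon : ∀ (α : ι →₀ ℕ) (c : ℝ), ρ (MvPolynomial.monomial α c) =
      if ∑ i ∈ s, α i = 0 then MvPolynomial.monomial α c else 0 := by
    intro α c
    rw [hρ, MvPolynomial.aeval_monomial]
    split_ifs with h0
    · rw [MvPolynomial.monomial_eq]
      congr 1
      refine Finset.prod_congr rfl fun i hi => ?_
      have : i ∉ s := fun his => (Finsupp.mem_support_iff.1 hi) (Finset.sum_eq_zero_iff.1 h0 i his)
      simp [this]
    · obtain ⟨i, hi, hαi⟩ := Finset.exists_ne_zero_of_sum_ne_zero h0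
      rw [Finsupp.prod, Finset.prod_eq_zero (Finsupp.mem_support_iff.2 hαi) (by simp [hi, hαi]),
        mul_zero]
  have hcoeff : ∀ α : ι →₀ ℕ, ∑ i ∈ s, α i = 0 → (ρ q).coeff α = q.coeff α := by
    intro α hα
    clear hcone h hq
    induction q using MvPolynomial.induction_on' with
    | monomial β c =>
      rw [hmon]
      split_ifs with h0
      · rfl
      · rw [MvPolynomial.coeff_monomial, if_neg, MvPolynomial.coeff_zero]
        rintro rfl; exact h0 hα
    | add p q hp hq => rw [map_add, MvPolynomial.coeff_add, MvPolynomial.coeff_add, hp, hq]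
  have hzero : ρ q = 0 := by
    refine MvPolynomial.funext_set (fun _ => Set.Ioi (0 : ℝ)) (fun _ => Set.Ioi_infinite 0) ?_
    intro w hw
    have hw' : ∀ i, 0 < w i := fun i => hw i trivial
    rw [map_zero]
    have : MvPolynomial.eval w (ρ q) = MvPolynomial.eval (fun i => if i ∈ s then 0 else w i) q := by
      have hcomp : (MvPolynomial.eval w).comp (ρ : MvPolynomial ι ℝ →+* MvPolynomial ι ℝ) =
          MvPolynomial.eval (fun i => if i ∈ s then 0 else w i) := by
        refine MvPolynomial.ringHom_ext (fun c => by simp [hρ]) fun i => ?_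
        by_cases hi : i ∈ s <;> simp [hρ, hi]
      exact congrArg (fun φ : MvPolynomial ι ℝ →+* ℝ => φ q) hcomp
    rw [this]
    refine hcone _ (fun i => ?_) (fun i hi => by simp [hi]) ?_
    · split_ifs <;> [rfl; exact (hw' i).le]
    · obtain ⟨j, hj⟩ : ∃ j, j ∉ s := by
        by_contra! hc; exact hs (Finset.eq_univ_iff_forall.2 hc)
      refine Finset.sum_pos' (fun i _ => ?_) ⟨j, Finset.mem_univ _, by simp [hj, hw' j]⟩
      split_ifs <;> [rfl; exact (hw' i).le]
  intro α hα
  rw [← hcoeff α (by omega), hzero, MvPolynomial.coeff_zero]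

end Vanishing

/-! ### Directional derivatives as derivations on polynomials in barycentric coordinates. -/

section Bary
variable {d : ℕ} {ι : Type*} (b : AffineBasis ι ℝ (Space d))

/-- The linear part of a barycentric coordinate. -/
noncomputable def baryLinear (i : ι) : Space d →ₗ[ℝ] ℝ := (b.coord i).linear

lemma coord_add_smul (i : ι) (x y : Space d) (t : ℝ) :
    b.coord i (x + t • y) = b.coord i x + t * baryLinear b i y := by
  rw [add_comm x, ← vadd_eq_add, AffineMap.map_vadd, map_smul, vadd_eq_add, smul_eq_mul, add_comm,
    baryLinear]

/-- The function on `ℝ^d` given by a polynomial in the barycentric coordinates. -/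
noncomputable def baryPoly : MvPolynomial ι ℝ →ₗ[ℝ] (Space d → ℝ) :=
  LinearMap.pi fun x => (MvPolynomial.aeval (fun i => b.coord i x)).toLinearMap

lemma baryPoly_apply (p : MvPolynomial ι ℝ) (x : Space d) :
    baryPoly b p x = MvPolynomial.eval (fun i => b.coord i x) p := by
  simp [baryPoly, MvPolynomial.aeval_eq_eval]

lemma baryPoly_mul (p q : MvPolynomial ι ℝ) (x : Space d) :
    baryPoly b (p * q) x = baryPoly b p x * baryPoly b q x := by
  simp [baryPoly_apply]

lemma baryPoly_contDiff (p : MvPolynomial ι ℝ) : ContDiff ℝ ⊤ (baryPoly b p) := by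
  induction p using MvPolynomial.induction_on with
  | C c =>
    have : baryPoly b (MvPolynomial.C c) = fun _ => c := by funext x; simp [baryPoly_apply]
    rw [this]; exact contDiff_const
  | add p q hp hq => rw [map_add]; exact hp.add hq
  | mul_X p i hp =>
    have hi : ContDiff ℝ ⊤ (b.coord i) :=
      ContinuousAffineMap.contDiff ⟨b.coord i, (b.coord i).continuous_of_finiteDimensional⟩
    have : baryPoly b (p * MvPolynomial.X i) = fun x => baryPoly b p x * b.coord i x := by
      funext x; simp [baryPoly_apply]
    rw [this]; exact hp.mul hi

lemma baryPoly_eq_zero_of_mem_vanishOrder {s : Finset ι} {p : MvPolynomial ι ℝ}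
    (hp : p ∈ vanishOrder s 1) {x : Space d} (hx : ∀ i ∈ s, b.coord i x = 0) :
    baryPoly b p x = 0 := by
  rw [baryPoly_apply, MvPolynomial.eval_eq]
  refine Finset.sum_eq_zero fun α hα => ?_
  have h0 : ∑ i ∈ s, α i ≠ 0 := fun h => MvPolynomial.mem_support_iff.1 hα (hp α (by omega))
  obtain ⟨i, hi, hαi⟩ := Finset.exists_ne_zero_of_sum_ne_zero h0
  rw [Finset.prod_eq_zero (Finsupp.mem_support_iff.2 hαi) (by simp [hx i hi, hαi]), mul_zero]

variable [Fintype ι]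

/-- The directional derivative in terms of barycentric coordinates. -/
noncomputable def baryDeriv : Space d →ₗ[ℝ] Derivation ℝ (MvPolynomial ι ℝ) (MvPolynomial ι ℝ) where
  toFun y := ∑ i, baryLinear b i y • MvPolynomial.pderiv i
  map_add' y z := by simp [add_smul, Finset.sum_add_distrib]
  map_smul' c y := by simp [Finset.smul_sum, smul_smul]

lemma baryDeriv_apply (y : Space d) (p : MvPolynomial ι ℝ) :
    baryDeriv b y p = ∑ i, baryLinear b i y • MvPolynomial.pderiv i p := by
  have := map_sum (Derivation.coeFnAddMonoidHom (R := ℝ) (A := MvPolynomial ι ℝ)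
    (M := MvPolynomial ι ℝ)) (fun i => baryLinear b i y • MvPolynomial.pderiv i) Finset.univ
  exact (congrFun this p).trans (by simp [Finset.sum_apply])

lemma baryDeriv_X (y : Space d) (i : ι) :
    baryDeriv b y (MvPolynomial.X i) = MvPolynomial.C (baryLinear b i y) := by
  classical
  rw [baryDeriv_apply, Finset.sum_eq_single i]
  · simp [MvPolynomial.smul_eq_C_mul]
  · intro j _ hj; simp [MvPolynomial.pderiv_X_of_ne hj.symm]
  · simp

/-- The commutator is again a derivation, and it kills the variables because their derivatives are
constants. -/
lemma baryDeriv_comm (y z : Space d) (p : MvPolynomial ι ℝ) :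
    baryDeriv b y (baryDeriv b z p) = baryDeriv b z (baryDeriv b y p) := by
  have h : ⁅baryDeriv b y, baryDeriv b z⁆ = 0 := by
    ext1 i
    simp [Derivation.commutator_apply, baryDeriv_X]
  have := congrArg (fun D : Derivation ℝ (MvPolynomial ι ℝ) (MvPolynomial ι ℝ) => D p) h
  simpa [Derivation.commutator_apply, sub_eq_zero] using this

lemma baryDeriv_isHomogeneous {p : MvPolynomial ι ℝ} {m : ℕ} (hp : p.IsHomogeneous m)
    (y : Space d) : (baryDeriv b y p).IsHomogeneous (m - 1) := by
  rw [baryDeriv_apply]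
  refine MvPolynomial.IsHomogeneous.sum _ _ _ fun i _ => ?_
  rw [MvPolynomial.smul_eq_C_mul]
  exact (hp.pderiv).C_mul _

lemma baryDeriv_mem_vanishOrder (s : Finset ι) (N : ℕ) (y : Space d) {p : MvPolynomial ι ℝ}
    (hp : p ∈ vanishOrder s (N + 1)) : baryDeriv b y p ∈ vanishOrder s N := by
  rw [baryDeriv_apply]
  exact Submodule.sum_mem _ fun i _ => Submodule.smul_mem _ _ (pderiv_mem_vanishOrder s N i hp)

lemma hasLineDerivAt_baryPoly (p : MvPolynomial ι ℝ) (x y : Space d) :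
    HasLineDerivAt ℝ (baryPoly b p) (baryPoly b (baryDeriv b y p) x) x y := by
  unfold HasLineDerivAt
  induction p using MvPolynomial.induction_on with
  | C c => simpa [baryPoly_apply, MvPolynomial.algebraMap_eq] using hasDerivAt_const (0 : ℝ) c
  | add p q hp hq =>
    rw [map_add, map_add, map_add]
    exact hp.add hq
  | mul_X p i hp =>
    have hX : HasDerivAt (fun t : ℝ => b.coord i (x + t • y)) (baryLinear b i y) 0 := by
      simp_rw [coord_add_smul]
      simpa using ((hasDerivAt_id (0 : ℝ)).mul_const (baryLinear b i y)).const_add (b.coord i x)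
    have := hp.mul hX
    refine (this.congr_deriv ?_).congr_of_eventuallyEq (Filter.Eventually.of_forall fun t => ?_)
    · simp [baryPoly_apply, baryDeriv_X]
      ring
    · simp [baryPoly_apply]

lemma dirDeriv_baryPoly (p : MvPolynomial ι ℝ) (y : Space d) :
    dirDeriv y (baryPoly b p) = baryPoly b (baryDeriv b y p) :=
  funext fun x => (hasLineDerivAt_baryPoly b p x y).lineDeriv

/-- Iterated derivatives of barycentric polynomials along a word of directions. -/
noncomputable def wordDeriv {κ : Type*} (n : κ → Space d) (l : List κ) (p : MvPolynomial ι ℝ) :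
    MvPolynomial ι ℝ :=
  l.foldr (fun i q => baryDeriv b (n i) q) p

/-- The word in which the letter `i` occurs `θ i` times. -/
def thetaWord {m : ℕ} (θ : Fin m → ℕ) : List (Fin m) :=
  (List.ofFn fun i => List.replicate (θ i) i).flatten

/-- Words suit inductions that add one direction at a time, while the degrees of freedom use
multi-indices; since derivatives commute, this passes from the former to the latter. -/
lemma thetaWord_count_perm {m : ℕ} (l : List (Fin m)) :
    l.Perm (thetaWord fun i => l.count i) := by
  rw [List.perm_iff_count]
  intro i
  rw [thetaWord, List.count_flatten, List.map_ofFn, List.sum_ofFn]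
  simp [List.count_replicate]

lemma thetaWord_length {m : ℕ} (θ : Fin m → ℕ) : (thetaWord θ).length = ∑ i, θ i := by
  rw [thetaWord, List.length_flatten, List.map_ofFn, List.sum_ofFn]
  simp

lemma wordDeriv_perm {κ : Type*} (n : κ → Space d) {l l' : List κ} (h : l.Perm l')
    (p : MvPolynomial ι ℝ) : wordDeriv b n l p = wordDeriv b n l' p :=
  h.foldr_eq' (fun i _ j _ q => baryDeriv_comm b (n j) (n i) q) p

lemma wordDeriv_add {κ : Type*} (n : κ → Space d) (l : List κ) (p q : MvPolynomial ι ℝ) :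
    wordDeriv b n l (p + q) = wordDeriv b n l p + wordDeriv b n l q := by
  induction l with
  | nil => rfl
  | cons i l ih => exact (congrArg _ ih).trans (map_add _ _ _)

lemma wordDeriv_smul {κ : Type*} (n : κ → Space d) (l : List κ) (c : ℝ) (p : MvPolynomial ι ℝ) :
    wordDeriv b n l (c • p) = c • wordDeriv b n l p := by
  induction l with
  | nil => rfl
  | cons i l ih => exact (congrArg _ ih).trans (Derivation.map_smul _ _ _)

lemma iterDirDeriv_baryPoly {m : ℕ} (n : Fin m → Space d) (θ : Fin m → ℕ)
    (p : MvPolynomial ι ℝ) :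
    iterDirDeriv n θ (baryPoly b p) = baryPoly b (wordDeriv b n (thetaWord θ) p) := by
  have hit : ∀ (i : Fin m) (a : ℕ) (q : MvPolynomial ι ℝ), (dirDeriv (n i))^[a] (baryPoly b q) =
      baryPoly b ((List.replicate a i).foldr (fun i q => baryDeriv b (n i) q) q) := by
    intro i a q
    induction a with
    | zero => rfl
    | succ a ih =>
      rw [Function.iterate_succ_apply', ih, dirDeriv_baryPoly, List.replicate_succ, List.foldr_cons]
  rw [iterDirDeriv, wordDeriv, thetaWord, List.foldr_flatten, List.ofFn_eq_map, List.ofFn_eq_map,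
    List.foldr_map, List.foldr_map]
  generalize List.finRange m = l
  induction l with
  | nil => rfl
  | cons i l ih => simp only [List.foldr_cons, ih, hit]

lemma wordDeriv_isHomogeneous {κ : Type*} (n : κ → Space d) (l : List κ) {p : MvPolynomial ι ℝ}
    {m : ℕ} (hp : p.IsHomogeneous m) : (wordDeriv b n l p).IsHomogeneous (m - l.length) := by
  induction l with
  | nil => exact hp
  | cons i l ih =>
    have := baryDeriv_isHomogeneous b ih (n i)
    rwa [Nat.sub_sub] at this

lemma wordDeriv_mem_vanishOrder {κ : Type*} (n : κ → Space d) (l : List κ) {p : MvPolynomial ι ℝ}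
    {s : Finset ι} {N : ℕ} (hp : p ∈ vanishOrder s N) :
    wordDeriv b n l p ∈ vanishOrder s (N - l.length) := by
  induction l with
  | nil => exact hp
  | cons i l ih =>
    by_cases h : l.length < N
    · refine baryDeriv_mem_vanishOrder b s _ (n i) ?_
      have : N - (i :: l).length + 1 = N - l.length := by simp; omega
      rwa [this]
    -- The subtraction is truncated here, and vanishing to order zero is no condition.
    · have : N - (i :: l).length = 0 := by simp; omega
      rw [this]
      exact vanishOrder_zero _ _

/-- A polynomial vanishing to order `j` along a face whose derivatives of order `j` in transversal
directions vanish on the face vanishes to order `j + 1` along the face. -/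
lemma mem_vanishOrder_succ_of_wordDeriv {κ : Type*} (n : κ → Space d) {s : Finset ι}
    (hn : ∀ i ∈ s, ∃ y ∈ Submodule.span ℝ (Set.range n), baryLinear b i y = 1 ∧
      ∀ j ∈ s, j ≠ i → baryLinear b j y = 0) (j : ℕ) :
    ∀ p : MvPolynomial ι ℝ, p ∈ vanishOrder s j →
      (∀ l : List κ, l.length = j → wordDeriv b n l p ∈ vanishOrder s 1) →
      p ∈ vanishOrder s (j + 1) := by
  classical
  induction j with
  | zero => exact fun p _ h => h [] rfl
  | succ j ih =>
    intro p hp h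
    refine mem_vanishOrder_succ_of_pderiv hp fun i hi => ?_
    -- The induction hypothesis is applied to the derivative of p along `n c`. As `foldr` applies
    -- the last letter first, its words `l` correspond to the words `l ++ [c]` for p.
    have hspan : ∀ y ∈ Submodule.span ℝ (Set.range n),
        baryDeriv b y p ∈ vanishOrder s (j + 1) := by
      intro y hy
      induction hy using Submodule.span_induction with
      | mem y hy =>
        obtain ⟨c, rfl⟩ := hy
        refine ih _ (baryDeriv_mem_vanishOrder b s j _ hp) fun l hl => ?_
        have := h (l ++ [c]) (by simp [hl])
        simpa [wordDeriv, List.foldr_append] using this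
      | zero => simp
      | add y z _ _ hy hz => simpa using add_mem hy hz
      | smul c y _ hy => simpa using Submodule.smul_mem _ c hy
    obtain ⟨y, hy, hy1, hy0⟩ := hn i hi
    have hD := hspan y hy
    -- For the dual direction y, the derivative is the i-th partial plus partials in variables
    -- outside s, and the latter do not lower the order of vanishing.
    rw [baryDeriv_apply, ← Finset.add_sum_erase _ _ (Finset.mem_univ i), hy1, one_smul] at hD
    refine (Submodule.add_mem_iff_left _ (Submodule.sum_mem _ fun c hc => ?_)).1 hD
    by_cases hcs : c ∈ s
    · rw [hy0 c hcs (Finset.ne_of_mem_erase hc), zero_smul]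
      exact zero_mem _
    · exact Submodule.smul_mem _ _ (pderiv_mem_vanishOrder_of_notMem s _ hcs hp)

lemma fderiv_baryPoly_apply (p : MvPolynomial ι ℝ) (x y : Space d) :
    fderiv ℝ (baryPoly b p) x y = baryPoly b (baryDeriv b y p) x := by
  rw [← (hasLineDerivAt_baryPoly b p x y).lineDeriv]
  exact (((baryPoly_contDiff b p).differentiable (by simp)).differentiableAt.lineDeriv_eq_fderiv).symm

/-- The innermost derivative is replaced by a formal one, which costs one order of vanishing and
leaves a derivative of order j of a polynomial of the same kind. -/
lemma iteratedFDeriv_baryPoly_eq_zero {s : Finset ι} {x : Space d}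
    (hx : ∀ i ∈ s, b.coord i x = 0) (j : ℕ) :
    ∀ p : MvPolynomial ι ℝ, p ∈ vanishOrder s (j + 1) → iteratedFDeriv ℝ j (baryPoly b p) x = 0 := by
  induction j with
  | zero =>
    intro p hp
    ext v
    simpa using baryPoly_eq_zero_of_mem_vanishOrder b hp hx
  | succ j ih =>
    intro p hp
    ext v
    rw [iteratedFDeriv_succ_apply_right]
    have h := ih _ (baryDeriv_mem_vanishOrder b s (j + 1) (v (Fin.last j)) hp)
    have h2 : baryPoly b (baryDeriv b (v (Fin.last j)) p) =
        fun y => fderiv ℝ (baryPoly b p) y (v (Fin.last j)) :=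
      funext fun y => (fderiv_baryPoly_apply b p y _).symm
    have hc : ContDiff ℝ j (fderiv ℝ (baryPoly b p)) :=
      (baryPoly_contDiff b p).fderiv_right le_top
    rw [h2] at h
    have h3 := iteratedFDeriv_clm_apply_const_apply hc le_rfl (x := x) (u := v (Fin.last j))
      (m := Fin.init v)
    rw [h] at h3
    exact h3.symm

end Bary

/-! ### Faces of a simplex, their opposite vertices and normal frames. -/

section Simplex
variable {d : ℕ} {V : Finset (Space d)}

/-- The vertices of a nondegenerate `d`-simplex, as an affine basis. -/
noncomputable def simplexBasis (hV : IsTopSimplex V) : AffineBasis V ℝ (Space d) where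
  toFun := (↑)
  ind' := hV.2
  tot' := by
    rw [hV.2.affineSpan_eq_top_iff_card_eq_finrank_add_one]
    simp [hV.1]

@[simp] lemma simplexBasis_apply (hV : IsTopSimplex V) (v : V) : simplexBasis hV v = v := rfl

lemma sum_coord_smul (hV : IsTopSimplex V) (x : Space d) :
    ∑ v : V, (simplexBasis hV).coord v x • (v : Space d) = x :=
  (simplexBasis hV).linear_combination_coord_eq_self x

lemma coord_sum_smul (hV : IsTopSimplex V) {w : V → ℝ} (hw : ∑ v, w v = 1) (v : V) :
    (simplexBasis hV).coord v (∑ v, w v • (v : Space d)) = w v := by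
  have := (simplexBasis hV).coord_apply_combination_of_mem (Finset.mem_univ v) hw
  rwa [Finset.univ.affineCombination_eq_linear_combination _ _ hw] at this

open Classical in
/-- The vertices of `V` opposite to the face `σ`. -/
noncomputable def oppositeVertices (V σ : Finset (Space d)) : Finset V := {v | (v : Space d) ∉ σ}

lemma mem_oppositeVertices {σ : Finset (Space d)} {v : V} :
    v ∈ oppositeVertices V σ ↔ (v : Space d) ∉ σ := by simp [oppositeVertices]

lemma card_oppositeVertices (hV : IsTopSimplex V) {σ : Finset (Space d)} (h : σ ⊆ V) :
    (oppositeVertices V σ).card = codim σ := by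
  classical
  have h1 : (oppositeVertices V σ).card = (V \ σ).card := by
    refine Finset.card_bij (fun v _ => (v : Space d)) (fun v hv => ?_) (fun _ _ _ _ h => Subtype.ext h)
      (fun v hv => ?_)
    · exact Finset.mem_sdiff.2 ⟨v.2, mem_oppositeVertices.1 hv⟩
    · obtain ⟨h1, h2⟩ := Finset.mem_sdiff.1 hv
      exact ⟨⟨v, h1⟩, mem_oppositeVertices.2 h2, rfl⟩
  rw [h1, Finset.card_sdiff_of_subset h, hV.1, codim]

lemma oppositeVertices_ne_univ {σ : Finset (Space d)} (h : σ ⊆ V) (hne : σ.Nonempty) :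
    oppositeVertices V σ ≠ Finset.univ := by
  obtain ⟨v, hv⟩ := hne
  intro hu
  have : (⟨v, h hv⟩ : V) ∈ oppositeVertices V σ := hu ▸ Finset.mem_univ _
  exact mem_oppositeVertices.1 this hv

lemma face_indep (hV : IsTopSimplex V) {σ : Finset (Space d)} (h : σ ⊆ V) :
    AffineIndependent ℝ ((↑) : σ → Space d) :=
  hV.2.mono (show (σ : Set (Space d)) ⊆ V from Finset.coe_subset.2 h)

lemma coord_eq_zero_of_mem_hull (hV : IsTopSimplex V) {σ : Finset (Space d)} (h : σ ⊆ V)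
    {x : Space d} (hx : x ∈ convexHull ℝ (σ : Set (Space d))) {v : V} (hv : (v : Space d) ∉ σ) :
    (simplexBasis hV).coord v x = 0 := by
  have hconv : Convex ℝ ((simplexBasis hV).coord v ⁻¹' {0}) :=
    (convex_singleton 0).affine_preimage _
  refine convexHull_min (fun y hy => ?_) hconv hx
  have hvy : v ≠ ⟨y, h hy⟩ := fun hc => hv (by rw [hc]; exact hy)
  have h0 := (simplexBasis hV).coord_apply_ne hvy
  rw [simplexBasis_apply] at h0
  exact h0

lemma sum_face {M : Type*} [AddCommMonoid M] {σ : Finset (Space d)} (h : σ ⊆ V) (f : V → M)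
    (hf : ∀ v : V, (v : Space d) ∉ σ → f v = 0) :
    ∑ v : V, f v = ∑ v : σ, f ⟨v, h v.2⟩ := by
  classical
  refine (Finset.sum_of_injOn (fun v : σ => (⟨v, h v.2⟩ : V)) (fun a _ b _ hab => ?_)
    (by simp) (fun v _ hv => ?_) (fun _ _ => rfl)).symm
  · exact Subtype.ext (congrArg (fun z : V => (z : Space d)) hab)
  · refine hf v fun hvσ => hv ⟨⟨v, hvσ⟩, by simp, rfl⟩

/-- On σ the coordinates of the other vertices of V vanish, so the remaining ones are admissible
weights; affine independence makes the weights chosen in `bary` equal to them. -/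
lemma bary_eq_coord (hV : IsTopSimplex V) {σ : Finset (Space d)} (h : σ ⊆ V)
    {x : Space d} (hx : x ∈ convexHull ℝ (σ : Set (Space d))) (v : σ) :
    bary σ v x = (simplexBasis hV).coord ⟨v, h v.2⟩ x := by
  set c : σ → ℝ := fun v => (simplexBasis hV).coord ⟨v, h v.2⟩ x with hc
  have h1 : ∑ v, c v = 1 := by
    rw [← (simplexBasis hV).sum_coord_apply_eq_one x,
      sum_face h _ fun v hv => coord_eq_zero_of_mem_hull hV h hx hv]
  have h2 : ∑ v, c v • (v : Space d) = x := by
    conv_rhs => rw [← sum_coord_smul hV x]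
    rw [sum_face h (fun v : V => (simplexBasis hV).coord v x • (v : Space d)) fun v hv => by
      rw [coord_eq_zero_of_mem_hull hV h hx hv, zero_smul]]
  have hex : ∃ w : σ → ℝ, ∑ y, w y = 1 ∧ ∑ y, w y • (y : Space d) = x := ⟨c, h1, h2⟩
  rw [bary, dif_pos hex]
  obtain ⟨h3, h4⟩ := hex.choose_spec
  have := (affineIndependent_iff_eq_of_fintype_affineCombination_eq ℝ ((↑) : σ → Space d)).1
    (face_indep hV h) hex.choose c h3 h1
    (by rw [Finset.univ.affineCombination_eq_linear_combination _ _ h3,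
          Finset.univ.affineCombination_eq_linear_combination _ _ h1, h4, h2])
  exact congrFun this v

/-- Extension by zero of a multi-index on a face. -/
noncomputable def extendIndex (V : Finset (Space d)) {σ : Finset (Space d)} (β : σ → ℕ) : V →₀ ℕ :=
  open Classical in
  Finsupp.equivFunOnFinite.symm fun v => if h : (v : Space d) ∈ σ then β ⟨v, h⟩ else 0

lemma extendIndex_of_mem {σ : Finset (Space d)} (β : σ → ℕ) {v : V} (h : (v : Space d) ∈ σ) :
    extendIndex V β v = β ⟨v, h⟩ := by simp [extendIndex, h]

lemma extendIndex_of_notMem {σ : Finset (Space d)} (β : σ → ℕ) {v : V} (h : (v : Space d) ∉ σ) :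
    extendIndex V β v = 0 := by simp [extendIndex, h]

lemma baryMonomial_eq_baryPoly (hV : IsTopSimplex V) {σ : Finset (Space d)} (h : σ ⊆ V)
    {x : Space d} (hx : x ∈ convexHull ℝ (σ : Set (Space d))) (β : σ → ℕ) :
    baryMonomial σ β x =
      baryPoly (simplexBasis hV) (MvPolynomial.monomial (extendIndex V β) 1) x := by
  classical
  rw [baryPoly_apply, MvPolynomial.eval_monomial, one_mul, baryMonomial,
    Finsupp.prod_fintype _ _ (by simp)]
  refine Finset.prod_of_injOn (fun v : σ => (⟨v, h v.2⟩ : V)) (fun a _ b _ hab => ?_)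
    (by simp) (fun v _ hv => ?_) (fun v _ => ?_)
  · exact Subtype.ext (congrArg (fun z : V => (z : Space d)) hab)
  · have : (v : Space d) ∉ σ := fun hvσ => hv ⟨⟨v, hvσ⟩, by simp, rfl⟩
    rw [extendIndex_of_notMem β this, pow_zero]
  · rw [extendIndex_of_mem β (v := ⟨v, h v.2⟩) v.2, bary_eq_coord hV h hx]

lemma mem_vanishOrder_one_of_hull (hV : IsTopSimplex V) {σ : Finset (Space d)} (h : σ ⊆ V)
    (hne : σ.Nonempty) {m : ℕ} {q : MvPolynomial V ℝ} (hq : q.IsHomogeneous m)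
    (h0 : ∀ x ∈ convexHull ℝ (σ : Set (Space d)), baryPoly (simplexBasis hV) q x = 0) :
    q ∈ vanishOrder (oppositeVertices V σ) 1 := by
  classical
  refine mem_vanishOrder_one_of_eval_eq_zero hq (oppositeVertices_ne_univ h hne) ?_
  intro w hw0 hws hw1
  have hx : ∑ v : V, w v • (v : Space d) ∈ convexHull ℝ (σ : Set (Space d)) := by
    rw [sum_face h (fun v : V => w v • (v : Space d)) fun v hv => by
      rw [hws v (mem_oppositeVertices.2 hv), zero_smul]]
    refine (convex_convexHull ℝ _).sum_mem (fun v _ => hw0 _) ?_ fun v _ =>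
      subset_convexHull ℝ _ v.2
    rw [← hw1, sum_face h w fun v hv => hws v (mem_oppositeVertices.2 hv)]
  have := h0 _ hx
  rw [baryPoly_apply] at this
  rw [← this]
  congr 1
  congr 1
  funext v
  exact (coord_sum_smul hV hw1 v).symm

/-- Expand p + y and p in barycentric coordinates and subtract; the base point is free because the
linear parts sum to zero. -/
lemma sum_baryLinear_smul_sub (hV : IsTopSimplex V) (p y : Space d) :
    ∑ v : V, baryLinear (simplexBasis hV) v y • ((v : Space d) - p) = y := by
  have h1 : ∀ v : V, baryLinear (simplexBasis hV) v y =
      (simplexBasis hV).coord v (p + y) - (simplexBasis hV).coord v p := by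
    intro v
    have := coord_add_smul (simplexBasis hV) v p y 1
    rw [one_smul, one_mul] at this
    rw [this]; ring
  simp only [h1, smul_sub, sub_smul, Finset.sum_sub_distrib, sum_coord_smul, ← Finset.sum_smul,
    AffineBasis.sum_coord_apply_eq_one]
  simp

/-- The normals are transversal to σ: a combination of them on which all opposite coordinates have
zero slope is tangent to σ and also orthogonal to it, hence zero. The linear system is square, so
injectivity yields the dual directions. -/
lemma exists_dual_of_isNormalFrame (hV : IsTopSimplex V) {σ : Finset (Space d)} (h : σ ⊆ V)
    (hne : σ.Nonempty) {n : Fin (codim σ) → Space d} (hn : IsNormalFrame σ n) :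
    ∀ i ∈ oppositeVertices V σ, ∃ y ∈ Submodule.span ℝ (Set.range n),
      baryLinear (simplexBasis hV) i y = 1 ∧
      ∀ j ∈ oppositeVertices V σ, j ≠ i → baryLinear (simplexBasis hV) j y = 0 := by
  classical
  set A : (Fin (codim σ) → ℝ) →ₗ[ℝ] (oppositeVertices V σ → ℝ) :=
    (LinearMap.pi fun i => baryLinear (simplexBasis hV) (i : V)) ∘ₗ Fintype.linearCombination ℝ n
    with hA
  have hinj : Function.Injective A := by
    rw [← LinearMap.ker_eq_bot, LinearMap.ker_eq_bot']
    intro t ht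
    set y := Fintype.linearCombination ℝ n t with hy
    have hy0 : ∀ v : V, (v : Space d) ∉ σ → baryLinear (simplexBasis hV) v y = 0 := fun v hv =>
      congrFun ht ⟨v, mem_oppositeVertices.2 hv⟩
    obtain ⟨p, hp⟩ := hne
    have hmem : y ∈ vectorSpan ℝ (σ : Set (Space d)) := by
      rw [← sum_baryLinear_smul_sub hV p y]
      refine Submodule.sum_mem _ fun v _ => ?_
      by_cases hv : (v : Space d) ∈ σ
      · exact Submodule.smul_mem _ _ (vsub_mem_vectorSpan ℝ hv hp)
      · rw [hy0 v hv, zero_smul]; exact zero_mem _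
    have hyy : inner ℝ y y = 0 := by
      conv_lhs => rw [hy, Fintype.linearCombination_apply, sum_inner]
      refine Finset.sum_eq_zero fun i _ => ?_
      rw [inner_smul_left, ← Fintype.linearCombination_apply, ← hy, hn.2.2 i y hmem, mul_zero]
    have hy00 : y = 0 := inner_self_eq_zero.1 hyy
    exact Fintype.linearIndependent_iff.1 hn.2.1 t (by
      rw [← Fintype.linearCombination_apply, ← hy, hy00]) |> funext
  have hsurj : Function.Surjective A :=
    (LinearMap.injective_iff_surjective_of_finrank_eq_finrank (by
      simp [card_oppositeVertices hV h])).1 hinj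
  intro i hi
  obtain ⟨t, ht⟩ := hsurj (Pi.single ⟨i, hi⟩ 1)
  refine ⟨Fintype.linearCombination ℝ n t, ?_, ?_, fun j hj hji => ?_⟩
  · rw [← Fintype.range_linearCombination]
    exact ⟨t, rfl⟩
  · have := congrFun ht ⟨i, hi⟩
    rwa [Pi.single_eq_same] at this
  · have := congrFun ht ⟨j, hj⟩
    rwa [Pi.single_eq_of_ne (by simpa using hji)] at this

/-- The mean over a face, on polynomials in the barycentric coordinates. -/
noncomputable def faceMean (hV : IsTopSimplex V) {σ : Finset (Space d)} (h : σ ⊆ V)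
    (hne : σ.Nonempty) : MvPolynomial V ℝ →ₗ[ℝ] ℝ where
  toFun q := ⨍ x in convexHull ℝ (σ : Set (Space d)), baryPoly (simplexBasis hV) q x ∂μHE[σ.card - 1]
  map_add' p q := by
    have hi := fun p => integrableOn_hull (face_indep hV h) hne
      (baryPoly_contDiff (simplexBasis hV) p).continuous
    simp only [setAverage_eq, map_add, Pi.add_apply]
    rw [integral_add (hi p) (hi q), smul_add]
  map_smul' c p := by
    simp only [setAverage_eq, map_smul, Pi.smul_apply, integral_smul, RingHom.id_apply]
    rw [smul_comm]

lemma faceMean_apply (hV : IsTopSimplex V) {σ : Finset (Space d)} (h : σ ⊆ V)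
    (hne : σ.Nonempty) (q : MvPolynomial V ℝ) : faceMean hV h hne q =
      ⨍ x in convexHull ℝ (σ : Set (Space d)), baryPoly (simplexBasis hV) q x ∂μHE[σ.card - 1] :=
  rfl

lemma dof_baryPoly (hV : IsTopSimplex V) {σ : Finset (Space d)} (h : σ ⊆ V) (hne : σ.Nonempty)
    (n : Fin (codim σ) → Space d) (θ : Fin (codim σ) → ℕ) (β : σ → ℕ) (p : MvPolynomial V ℝ) :
    dof σ n θ (baryMonomial σ β) (baryPoly (simplexBasis hV) p) =
      faceMean hV h hne (wordDeriv (simplexBasis hV) n (thetaWord θ) p *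
        MvPolynomial.monomial (extendIndex V β) 1) := by
  rw [dof, faceMean_apply, setAverage_eq, setAverage_eq]
  congr 1
  refine setIntegral_congr_fun (isCompact_hull σ).measurableSet fun x hx => ?_
  rw [iterDirDeriv_baryPoly, baryPoly_mul, baryMonomial_eq_baryPoly hV h hx]

lemma eq_zero_on_hull_of_faceMean_sq (hV : IsTopSimplex V) {σ : Finset (Space d)} (h : σ ⊆ V)
    (hne : σ.Nonempty) {q : MvPolynomial V ℝ} (hq : faceMean hV h hne (q * q) = 0) :
    ∀ x ∈ convexHull ℝ (σ : Set (Space d)), baryPoly (simplexBasis hV) q x = 0 := by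
  intro x hx
  have := eq_zero_on_hull_of_setAverage_eq_zero (face_indep hV h) hne
    (baryPoly_contDiff (simplexBasis hV) (q * q)).continuous
    (fun x => by rw [baryPoly_mul]; exact mul_self_nonneg _) hq x hx
  rwa [baryPoly_mul, mul_self_eq_zero] at this

lemma faceMean_congr (hV : IsTopSimplex V) {σ : Finset (Space d)} (h : σ ⊆ V)
    (hne : σ.Nonempty) {p q : MvPolynomial V ℝ}
    (hpq : ∀ x ∈ convexHull ℝ (σ : Set (Space d)),
      baryPoly (simplexBasis hV) p x = baryPoly (simplexBasis hV) q x) :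
    faceMean hV h hne p = faceMean hV h hne q := by
  rw [faceMean_apply, faceMean_apply, setAverage_eq, setAverage_eq]
  congr 1
  exact setIntegral_congr_fun (isCompact_hull σ).measurableSet hpq

end Simplex

/-! ### Vanishing degrees of freedom force vanishing along the faces. -/

section Determination
variable {d : ℕ} {V : Finset (Space d)} {r : ℕ → ℕ} {k : ℕ}

lemma Admissible.mono (hr : Admissible d r k) {i j : ℕ} (hi : 1 ≤ i) (hij : i ≤ j) (hj : j ≤ d) :
    r i ≤ r j := by
  induction j, hij using Nat.le_induction with
  | base => exact le_rfl
  | succ j hij ih =>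
    have h1 := ih (by omega)
    have h2 := hr.1 j (by omega) (by omega)
    omega

/-- The face of `σ` opposite to the vertices of `t`. -/
noncomputable def complFace {σ : Finset (Space d)} (t : Finset σ) : Finset (Space d) :=
  open Classical in
  tᶜ.map (Function.Embedding.subtype _)

lemma mem_complFace {σ : Finset (Space d)} {t : Finset σ} {v : Space d} :
    v ∈ complFace t ↔ ∃ h : v ∈ σ, ⟨v, h⟩ ∉ t := by
  classical
  simp [complFace]

lemma complFace_subset {σ : Finset (Space d)} (t : Finset σ) : complFace t ⊆ σ :=
  fun _ hv => (mem_complFace.1 hv).1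

lemma card_complFace {σ : Finset (Space d)} (t : Finset σ) :
    (complFace t).card + t.card = σ.card := by
  classical
  rw [complFace, Finset.card_map, Finset.card_compl_add_card]
  simp

lemma complFace_nonempty {σ : Finset (Space d)} {t : Finset σ} (ht : t ≠ Finset.univ) :
    (complFace t).Nonempty := by
  obtain ⟨v, hv⟩ : ∃ v, v ∉ t := by
    by_contra! hc; exact ht (Finset.eq_univ_iff_forall.2 hc)
  exact ⟨v, mem_complFace.2 ⟨v.2, hv⟩⟩

/-- Links the two descriptions of the index sets: a sum of the entries in `t` is a degree
transversal to the face of σ opposite to `t`. -/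
lemma sum_oppositeVertices_complFace {σ : Finset (Space d)} (h : σ ⊆ V) (t : Finset σ)
    (α : V → ℕ) : ∑ v ∈ oppositeVertices V (complFace t), α v =
      ∑ v ∈ oppositeVertices V σ, α v + ∑ v ∈ t, α ⟨v, h v.2⟩ := by
  classical
  have hinj : Function.Injective fun v : σ => (⟨v, h v.2⟩ : V) := fun a b hab =>
    Subtype.ext (congrArg (fun z : V => (z : Space d)) hab)
  have hset : oppositeVertices V (complFace t) = oppositeVertices V σ ∪ t.map ⟨_, hinj⟩ := by
    ext v
    simp only [mem_oppositeVertices, mem_complFace, Finset.mem_union, Finset.mem_map,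
      Function.Embedding.coeFn_mk]
    constructor
    · intro hv
      by_cases hvσ : (v : Space d) ∈ σ
      · refine Or.inr ⟨⟨v, hvσ⟩, ?_, rfl⟩
        by_contra hvt
        exact hv ⟨hvσ, hvt⟩
      · exact Or.inl hvσ
    · rintro (hv | ⟨a, ha, rfl⟩) ⟨h1, h2⟩
      · exact hv h1
      · exact h2 ha
  rw [hset, Finset.sum_union, Finset.sum_map]
  · rfl
  · rw [Finset.disjoint_left]
    intro v hv hvt
    obtain ⟨a, _, rfl⟩ := Finset.mem_map.1 hvt
    exact mem_oppositeVertices.1 hv a.2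

lemma codim_complFace {σ : Finset (Space d)} (t : Finset σ) (hσ : σ.card ≤ d + 1) :
    codim (complFace t) = t.card + codim σ := by
  have := card_complFace t
  rw [codim, codim]; omega

lemma sum_index_le_of_codim (hr : Admissible d r k) {σ τ : Finset (Space d)}
    {θ : Fin (codim σ) → ℕ} (hθ : θ ∈ orders r σ) (h : codim σ ≤ codim τ) (hτ : τ.Nonempty) :
    ∑ i, θ i ≤ r (codim τ) := by
  -- In codimension zero the value `r 0` is arbitrary, but there θ is empty.
  rcases Nat.eq_zero_or_pos (codim σ) with h0 | h0
  · have : IsEmpty (Fin (codim σ)) := by rw [h0]; infer_instance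
    simp
  · have hd : codim τ ≤ d := by
      have := hτ.card_pos
      rw [codim]; omega
    exact hθ.trans (hr.mono h0 h hd)

/-- A polynomial whose degrees of freedom vanish on all the subsimplices of a face vanishes on each
of them to the order given by `r`. -/
theorem mem_vanishOrder_of_dof_eq_zero (hr : Admissible d r k) (hV : IsTopSimplex V)
    {F : Finset (Space d)} (hF : F ⊆ V)
    {n : (σ : Finset (Space d)) → Fin (codim σ) → Space d}
    (hn : ∀ σ ⊆ F, σ.Nonempty → IsNormalFrame σ (n σ))
    {p : MvPolynomial V ℝ} (hp : p.IsHomogeneous k)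
    (h0 : ∀ σ ⊆ F, σ.Nonempty → ∀ θ ∈ orders r σ, ∀ β ∈ testIndices r k σ θ,
      dof σ (n σ) θ (baryMonomial σ β) (baryPoly (simplexBasis hV) p) = 0) (N : ℕ) :
    ∀ σ ⊆ F, σ.Nonempty → σ.card = N → p ∈ vanishOrder (oppositeVertices V σ) (r (codim σ) + 1) := by
  classical
  induction N using Nat.strong_induction_on with
  | _ N IH =>
  intro σ hσF hne hcard
  have hσ : σ ⊆ V := hσF.trans hF
  have hcard' : σ.card ≤ d + 1 := hV.1 ▸ Finset.card_le_card hσ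
  suffices H : ∀ j ≤ r (codim σ) + 1, p ∈ vanishOrder (oppositeVertices V σ) j from H _ le_rfl
  intro j
  induction j with
  | zero => exact fun _ => vanishOrder_zero _ _
  | succ j ih =>
  intro hj
  refine mem_vanishOrder_succ_of_wordDeriv (simplexBasis hV) (n σ)
    (exists_dual_of_isNormalFrame hV hσ hne (hn σ hσF hne)) j p (ih (by omega)) fun l hl => ?_
  set θ : Fin (codim σ) → ℕ := fun i => l.count i with hθ
  have hperm := thetaWord_count_perm l
  rw [wordDeriv_perm _ _ hperm]
  have hsum : ∑ i, θ i = j := by rw [← thetaWord_length, ← hperm.length_eq, hl]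
  have hlen : (thetaWord θ).length = j := by rw [thetaWord_length, hsum]
  have hord : θ ∈ orders r σ := by
    show ∑ i, θ i ≤ _
    omega
  set q := wordDeriv (simplexBasis hV) (n σ) (thetaWord θ) p with hq
  have hqhom : q.IsHomogeneous (k - j) := by
    have := wordDeriv_isHomogeneous (simplexBasis hV) (n σ) (thetaWord θ) hp
    rwa [hlen] at this
  refine mem_vanishOrder_one_of_hull hV hσ hne hqhom
    (eq_zero_on_hull_of_faceMean_sq hV hσ hne ?_)
  -- Only one factor is expanded: each monomial of q either is a test monomial on σ or vanishes on
  -- σ.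
  have hexp : q * q = ∑ α ∈ q.support, q.coeff α • (q * MvPolynomial.monomial α 1) := by
    have hs : q * q = q * ∑ α ∈ q.support, MvPolynomial.monomial α (q.coeff α) := by
      rw [← q.as_sum]
    rw [hs, Finset.mul_sum]
    refine Finset.sum_congr rfl fun α _ => ?_
    rw [← mul_smul_comm, MvPolynomial.smul_monomial, smul_eq_mul, mul_one]
  rw [hexp, map_sum]
  refine Finset.sum_eq_zero fun α hα => ?_
  rw [map_smul, smul_eq_mul]
  refine mul_eq_zero_of_right _ ?_
  by_cases hαs : ∑ v ∈ oppositeVertices V σ, α v = 0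
  · have hα0 : ∀ v : V, (v : Space d) ∉ σ → α v = 0 := fun v hv =>
      Finset.sum_eq_zero_iff.1 hαs v (mem_oppositeVertices.2 hv)
    set β : σ → ℕ := fun v => α ⟨v, hσ v.2⟩ with hβ
    have hαβ : extendIndex V β = α := by
      ext v
      by_cases hv : (v : Space d) ∈ σ
      · rw [extendIndex_of_mem β hv]
      · rw [extendIndex_of_notMem β hv, hα0 v hv]
    rw [← hαβ, ← dof_baryPoly]
    refine h0 σ hσF hne θ hord β ⟨?_, fun t ht htu => ?_⟩
    · have := hqhom (MvPolynomial.mem_support_iff.1 hα)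
      have h1 : ∑ v : V, α v = k - j := by
        simpa [Finsupp.weight_apply, Finsupp.sum_fintype] using this
      rw [hsum, ← h1, sum_face hσ α hα0]
    · have hτne := complFace_nonempty htu
      have hτcard := card_complFace t
      have htpos := ht.card_pos
      have hpτ := IH (complFace t).card (by omega) (complFace t) ((complFace_subset t).trans hσF)
        hτne rfl
      have hqτ := wordDeriv_mem_vanishOrder (simplexBasis hV) (n σ) (thetaWord θ) hpτ
      -- By the induction on dimension p vanishes to order r + 1 along the opposite face, so q
      -- vanishes there to order r + 1 - j; a smaller sum would make the coefficient of α zero. As j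
      -- ≤ r on that face, this is the strict inequality of the test set.
      have hle : r (codim (complFace t)) + 1 - j ≤ ∑ v ∈ t, β v := by
        by_contra! hlt
        refine MvPolynomial.mem_support_iff.1 hα (hqτ α ?_)
        rwa [sum_oppositeVertices_complFace hσ, hαs, zero_add, hlen]
      have hco := codim_complFace t hcard'
      have hjle := sum_index_le_of_codim hr hord (τ := complFace t) (by omega) hτne
      dsimp only
      rw [← hco]
      omega
  · rw [← map_zero (faceMean hV hσ hne)]
    refine faceMean_congr hV hσ hne fun x hx => ?_
    have hmem : MvPolynomial.monomial α (1 : ℝ) ∈ vanishOrder (oppositeVertices V σ) 1 := by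
      intro γ hγ
      rw [MvPolynomial.coeff_monomial, if_neg]
      rintro rfl; omega
    rw [baryPoly_mul, baryPoly_eq_zero_of_mem_vanishOrder _ hmem fun v hv =>
      coord_eq_zero_of_mem_hull hV hσ hx (mem_oppositeVertices.1 hv)]
    simp

end Determination

/-! ### P_k as the forms of degree k in barycentric coordinates. -/

section PolySpace
variable {d : ℕ} {V : Finset (Space d)} {k : ℕ}

lemma polyFun_apply (P : MvPolynomial (Fin d) ℝ) (x : Space d) :
    polyFun d P x = MvPolynomial.eval (fun i => x i) P := by
  simp [polyFun, MvPolynomial.aeval_eq_eval]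

/-- A barycentric coordinate as a polynomial in the cartesian coordinates. -/
noncomputable def coordPoly (hV : IsTopSimplex V) (v : V) : MvPolynomial (Fin d) ℝ :=
  MvPolynomial.C ((simplexBasis hV).coord v 0) + ∑ j, MvPolynomial.C
    (baryLinear (simplexBasis hV) v (EuclideanSpace.basisFun (Fin d) ℝ j)) * MvPolynomial.X j

lemma coordPoly_totalDegree (hV : IsTopSimplex V) (v : V) : (coordPoly hV v).totalDegree ≤ 1 := by
  refine (MvPolynomial.totalDegree_add _ _).trans (max_le (by simp) ?_)
  refine MvPolynomial.totalDegree_finsetSum_le fun j _ => ?_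
  refine (MvPolynomial.totalDegree_mul _ _).trans ?_
  simp

lemma eval_coordPoly (hV : IsTopSimplex V) (v : V) (x : Space d) :
    MvPolynomial.eval (fun i => x i) (coordPoly hV v) = (simplexBasis hV).coord v x := by
  have h := coord_add_smul (simplexBasis hV) v 0 x 1
  rw [one_smul, zero_add, one_mul] at h
  have hx := (EuclideanSpace.basisFun (Fin d) ℝ).sum_repr x
  rw [h]
  conv_rhs => rw [← hx]
  simp [coordPoly, mul_comm]

lemma baryPoly_mem_polySpace (hV : IsTopSimplex V) {p : MvPolynomial V ℝ} (hp : p.IsHomogeneous k) :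
    baryPoly (simplexBasis hV) p ∈ polySpace d k := by
  rw [p.as_sum, map_sum]
  refine Submodule.sum_mem _ fun α hα => ?_
  have hα : ∑ v : V, α v = k := by
    have := hp (MvPolynomial.mem_support_iff.1 hα)
    simpa [Finsupp.weight_apply, Finsupp.sum_fintype] using this
  refine ⟨MvPolynomial.C (p.coeff α) * ∏ v, coordPoly hV v ^ α v, ?_, ?_⟩
  · rw [SetLike.mem_coe, MvPolynomial.mem_restrictTotalDegree]
    refine (MvPolynomial.totalDegree_mul _ _).trans ?_
    rw [MvPolynomial.totalDegree_C, zero_add]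
    refine (MvPolynomial.totalDegree_finsetProd _ _).trans ?_
    rw [← hα]
    refine Finset.sum_le_sum fun v _ => (MvPolynomial.totalDegree_pow _ _).trans ?_
    exact (Nat.mul_le_mul_left _ (coordPoly_totalDegree hV v)).trans (mul_one _).le
  · funext x
    rw [polyFun_apply, baryPoly_apply, MvPolynomial.eval_monomial, Finsupp.prod_fintype _ _ (by simp)]
    simp [eval_coordPoly]

/-- A cartesian coordinate as a linear form in the barycentric coordinates. -/
noncomputable def cartesianForm (V : Finset (Space d)) (j : Fin d) : MvPolynomial V ℝ :=
  ∑ v : V, MvPolynomial.C ((v : Space d) j) * MvPolynomial.X v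

lemma cartesianForm_isHomogeneous (V : Finset (Space d)) (j : Fin d) :
    (cartesianForm V j).IsHomogeneous 1 :=
  MvPolynomial.IsHomogeneous.sum _ _ _ fun v _ => (MvPolynomial.isHomogeneous_X ℝ v).C_mul _

lemma eval_cartesianForm (hV : IsTopSimplex V) (j : Fin d) (x : Space d) :
    MvPolynomial.eval (fun v => (simplexBasis hV).coord v x) (cartesianForm V j) = x j := by
  conv_rhs => rw [← sum_coord_smul hV x]
  simp [cartesianForm, mul_comm]

/-- Homogenization: each cartesian coordinate is a linear form in the barycentric ones, and a
monomial of degree below k is padded with powers of their sum, which equals one. -/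
lemma exists_baryPoly_of_mem_polySpace (hV : IsTopSimplex V) {u : Space d → ℝ}
    (hu : u ∈ polySpace d k) :
    ∃ p : MvPolynomial V ℝ, p.IsHomogeneous k ∧ baryPoly (simplexBasis hV) p = u := by
  obtain ⟨P, hP, rfl⟩ := hu
  rw [SetLike.mem_coe, MvPolynomial.mem_restrictTotalDegree] at hP
  refine ⟨∑ a ∈ P.support, MvPolynomial.C (P.coeff a) *
    ((∑ v : V, MvPolynomial.X v) ^ (k - ∑ j, a j) * ∏ j, cartesianForm V j ^ a j), ?_, ?_⟩
  · refine MvPolynomial.IsHomogeneous.sum _ _ _ fun a ha => MvPolynomial.IsHomogeneous.C_mul ?_ _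
    have hak : ∑ j, a j ≤ k := by
      have := (MvPolynomial.le_totalDegree ha).trans hP
      rwa [Finsupp.sum_fintype _ _ (by simp)] at this
    have h1 : ((∑ v : V, MvPolynomial.X v : MvPolynomial V ℝ) ^ (k - ∑ j, a j)).IsHomogeneous
        (1 * (k - ∑ j, a j)) :=
      (MvPolynomial.IsHomogeneous.sum _ _ _ fun v _ => MvPolynomial.isHomogeneous_X ℝ v).pow _
    have h2 : (∏ j, cartesianForm V j ^ a j).IsHomogeneous (∑ j, 1 * a j) :=
      MvPolynomial.IsHomogeneous.prod _ _ _ fun j _ => (cartesianForm_isHomogeneous V j).pow _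
    have h3 := h1.mul h2
    simp only [one_mul] at h3
    rwa [Nat.sub_add_cancel hak] at h3
  · funext x
    rw [polyFun_apply, baryPoly_apply, MvPolynomial.eval_eq' _ P, map_sum]
    refine Finset.sum_congr rfl fun a _ => ?_
    have h1 := (simplexBasis hV).sum_coord_apply_eq_one x
    simp [eval_cartesianForm, -Finset.univ_eq_attach, h1]

end PolySpace

/-! ### Injecting the degrees of freedom into the multi-indices of weight k. -/

section Counting
variable {d : ℕ} {V : Finset (Space d)} {r : ℕ → ℕ} {k : ℕ}

lemma sum_oppositeVertices_inter_le {σ τ : Finset (Space d)} [DecidableEq (Space d)] (α : V → ℕ) :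
    ∑ v ∈ oppositeVertices V (σ ∩ τ), α v ≤
      ∑ v ∈ oppositeVertices V σ, α v + ∑ v ∈ oppositeVertices V τ, α v := by
  classical
  have h : oppositeVertices V (σ ∩ τ) = oppositeVertices V σ ∪ oppositeVertices V τ := by
    ext v
    simp only [mem_oppositeVertices, Finset.mem_union, Finset.mem_inter]
    tauto
  rw [h, ← Finset.sum_union_inter]
  omega

/-- The face on which a multi-index lives is the minimal one close to the multi-index. -/
lemma face_unique_of_codim_le (hr : Admissible d r k) (hV : IsTopSimplex V) {α : V → ℕ}
    (hα : ∑ v, α v = k) {σ τ : Finset (Space d)} (hσV : σ ⊆ V) (hτV : τ ⊆ V) (hσne : σ.Nonempty)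
    (hσ : ∑ v ∈ oppositeVertices V σ, α v ≤ r (codim σ))
    (hτ : ∑ v ∈ oppositeVertices V τ, α v ≤ r (codim τ))
    (hσ' : ∀ ρ ⊂ σ, ρ.Nonempty → r (codim ρ) < ∑ v ∈ oppositeVertices V ρ, α v)
    (hτ' : ∀ ρ ⊂ τ, ρ.Nonempty → r (codim ρ) < ∑ v ∈ oppositeVertices V ρ, α v)
    (hle : τ.card ≥ σ.card) : σ = τ := by
  classical
  by_contra hne
  -- A proper face σ of τ would contradict the minimality of τ. This also disposes of τ = V, where r
  -- is unconstrained.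
  by_cases hsub : σ ⊆ τ
  · have := hτ' σ (hsub.ssubset_of_ne hne) hσne
    omega
  have hρ : σ ∩ τ ⊂ σ := Finset.inter_subset_left.ssubset_of_ne fun h =>
    hsub (Finset.inter_eq_left.1 h)
  have hτcard : τ.card < d + 1 := by
    rw [← hV.1]
    refine Finset.card_lt_card (hτV.ssubset_of_ne ?_)
    rintro rfl
    exact hsub hσV
  have hρcard := Finset.card_lt_card hρ
  have hσpos := hσne.card_pos
  have h1 := sum_oppositeVertices_inter_le (V := V) (σ := σ) (τ := τ) α
  have h2 : r (codim τ) ≤ r (codim σ) :=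
    hr.mono (by rw [codim]; omega) (by rw [codim, codim]; omega) (by rw [codim]; omega)
  -- The transversal degree of σ ∩ τ is at most 2 r_m with m = `codim σ`. If the faces are disjoint
  -- it is k, against k ≥ 2 r_d + 1; otherwise minimality of σ makes it exceed r_{m+1} ≥ 2 r_m.
  rcases (σ ∩ τ).eq_empty_or_nonempty with h0 | h0
  · have h3 : r (codim σ) ≤ r d := hr.mono (by rw [codim]; omega) (by rw [codim]; omega) le_rfl
    have h4 : oppositeVertices V (σ ∩ τ) = Finset.univ := by
      ext v; simp [mem_oppositeVertices, h0]
    rw [h4, hα] at h1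
    have := hr.2
    omega
  · have h3 := hσ' _ hρ h0
    have hρpos := h0.card_pos
    have h4 := hr.1 (codim σ) (by rw [codim]; omega) (by rw [codim]; omega)
    have h5 : r (codim σ + 1) ≤ r (codim (σ ∩ τ)) :=
      hr.mono (by omega) (by rw [codim, codim]; omega) (by rw [codim]; omega)
    omega

lemma face_unique (hr : Admissible d r k) (hV : IsTopSimplex V) {α : V → ℕ}
    (hα : ∑ v, α v = k) {σ τ : Finset (Space d)} (hσV : σ ⊆ V) (hτV : τ ⊆ V) (hσne : σ.Nonempty)
    (hτne : τ.Nonempty)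
    (hσ : ∑ v ∈ oppositeVertices V σ, α v ≤ r (codim σ))
    (hτ : ∑ v ∈ oppositeVertices V τ, α v ≤ r (codim τ))
    (hσ' : ∀ ρ ⊂ σ, ρ.Nonempty → r (codim ρ) < ∑ v ∈ oppositeVertices V ρ, α v)
    (hτ' : ∀ ρ ⊂ τ, ρ.Nonempty → r (codim ρ) < ∑ v ∈ oppositeVertices V ρ, α v) : σ = τ := by
  rcases le_total σ.card τ.card with h | h
  · exact face_unique_of_codim_le hr hV hα hσV hτV hσne hσ hτ hσ' hτ' h
  · exact (face_unique_of_codim_le hr hV hα hτV hσV hτne hτ hσ hτ' hσ' h).symm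

/-- The multi-index on `V` with restriction `β` to `σ` and `θ` to the opposite vertices. -/
noncomputable def glueIndex (hV : IsTopSimplex V) {σ : Finset (Space d)} (h : σ ⊆ V)
    (θ : Fin (codim σ) → ℕ) (β : σ → ℕ) (v : V) : ℕ :=
  open Classical in
  if hv : (v : Space d) ∈ σ then β ⟨v, hv⟩ else
    θ (Finset.equivFinOfCardEq (card_oppositeVertices hV h) ⟨v, mem_oppositeVertices.2 hv⟩)

variable {hV : IsTopSimplex V} {σ : Finset (Space d)} {h : σ ⊆ V} {θ : Fin (codim σ) → ℕ}
  {β : σ → ℕ}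

lemma glueIndex_of_mem (v : σ) : glueIndex hV h θ β ⟨v, h v.2⟩ = β v := by
  simp [glueIndex]

lemma glueIndex_opposite (i : Fin (codim σ)) : glueIndex hV h θ β
    ((Finset.equivFinOfCardEq (card_oppositeVertices hV h)).symm i : V) = θ i := by
  have hi := mem_oppositeVertices.1
    ((Finset.equivFinOfCardEq (card_oppositeVertices hV h)).symm i).2
  rw [glueIndex, dif_neg hi]
  simp

lemma sum_opposite_glueIndex : ∑ v ∈ oppositeVertices V σ, glueIndex hV h θ β v = ∑ i, θ i := by
  rw [← Finset.sum_coe_sort,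
    ← (Finset.equivFinOfCardEq (card_oppositeVertices hV h)).symm.sum_comp]
  exact Finset.sum_congr rfl fun i _ => glueIndex_opposite i

lemma complFace_univ : complFace (Finset.univ : Finset σ) = ∅ := by
  ext v; simp [mem_complFace]

lemma sum_glueIndex : ∑ v, glueIndex hV h θ β v = ∑ i, θ i + ∑ v, β v := by
  have h1 := sum_oppositeVertices_complFace h Finset.univ (glueIndex hV h θ β)
  have h2 : oppositeVertices V (complFace (Finset.univ : Finset σ)) = Finset.univ := by
    rw [complFace_univ]; ext v; simp [mem_oppositeVertices]
  rw [h2, sum_opposite_glueIndex] at h1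
  rw [h1]
  exact congrArg _ (Finset.sum_congr rfl fun v _ => glueIndex_of_mem v)

lemma sum_order_le (hr : Admissible d r k) (hne : σ.Nonempty) (hθ : θ ∈ orders r σ) :
    ∑ i, θ i ≤ k := by
  rcases Nat.eq_zero_or_pos (codim σ) with h0 | h0
  · have : IsEmpty (Fin (codim σ)) := by rw [h0]; infer_instance
    simp
  · have := hne.card_pos
    have h1 := hr.mono h0 (show codim σ ≤ d by rw [codim]; omega) le_rfl
    have h2 := hr.2
    have h3 : ∑ i, θ i ≤ r (codim σ) := hθ
    omega

/-- This is the test condition for the vertices of σ outside ρ: the entries off σ contribute |θ|,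
which cancels the shift in q_t. -/
lemma lt_sum_opposite_glueIndex (hβ : β ∈ testIndices r k σ θ) {ρ : Finset (Space d)} (hρ : ρ ⊂ σ)
    (hρne : ρ.Nonempty) :
    r (codim ρ) < ∑ v ∈ oppositeVertices V ρ, glueIndex hV h θ β v := by
  classical
  set t : Finset σ := {v | (v : Space d) ∉ ρ} with ht
  have htρ : complFace t = ρ := by
    ext v
    rw [mem_complFace]
    constructor
    · rintro ⟨h1, h2⟩
      by_contra hv
      exact h2 (by simp [ht, hv])
    · exact fun hv => ⟨hρ.subset hv, by simp [ht, hv]⟩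
  have htne : t.Nonempty := by
    obtain ⟨v, hv, hvρ⟩ := Finset.exists_of_ssubset hρ
    exact ⟨⟨v, hv⟩, by simp [ht, hvρ]⟩
  have htu : t ≠ Finset.univ := by
    rintro hu
    rw [hu, complFace_univ] at htρ
    exact hρne.ne_empty htρ.symm
  have h1 := hβ.2 t htne htu
  have h2 := sum_oppositeVertices_complFace h t (glueIndex hV h θ β)
  have hco := codim_complFace t (hV.1 ▸ Finset.card_le_card h)
  rw [sum_opposite_glueIndex, Finset.sum_congr rfl fun v _ => glueIndex_of_mem v] at h2
  dsimp only at h1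
  rw [← hco] at h1
  rw [← htρ, h2]
  omega

variable (V r k) in
/-- The indices of the degrees of freedom on the subsimplices of `V`. -/
structure DofIndex where
  /-- the subsimplex -/
  face : Finset (Space d)
  /-- the order of differentiation -/
  order : Fin (codim face) → ℕ
  /-- the test monomial -/
  test : face → ℕ
  subset : face ⊆ V
  nonempty : face.Nonempty
  order_mem : order ∈ orders r face
  test_mem : test ∈ testIndices r k face order

/-- The multi-index on `V` associated to a degree of freedom. -/
noncomputable def DofIndex.toIndex (hr : Admissible d r k) (hV : IsTopSimplex V)
    (a : DofIndex V r k) : {α : V → ℕ // ∑ v, α v = k} :=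
  ⟨glueIndex hV a.subset a.order a.test, by
    rw [sum_glueIndex, a.test_mem.1, Nat.add_sub_cancel' (sum_order_le hr a.nonempty a.order_mem)]⟩

/-- The glued multi-index determines its face by `face_unique`, and then θ and β are read off as its
entries. Surjectivity need not be shown, since determination supplies the opposite inequality of
dimensions. -/
lemma DofIndex.toIndex_injective (hr : Admissible d r k) (hV : IsTopSimplex V) :
    Function.Injective (DofIndex.toIndex (V := V) hr hV) := by
  intro a b hab
  have hα := (b.toIndex hr hV).2
  have hab' : glueIndex hV a.subset a.order a.test = glueIndex hV b.subset b.order b.test :=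
    congrArg Subtype.val hab
  have hface : a.face = b.face := by
    refine face_unique hr hV hα a.subset b.subset a.nonempty b.nonempty ?_ ?_ ?_ ?_
    · change ∑ v ∈ _, glueIndex hV b.subset b.order b.test v ≤ _
      rw [← hab', sum_opposite_glueIndex]
      exact a.order_mem
    · change ∑ v ∈ _, glueIndex hV b.subset b.order b.test v ≤ _
      rw [sum_opposite_glueIndex]
      exact b.order_mem
    · intro ρ hρ hne
      change _ < ∑ v ∈ _, glueIndex hV b.subset b.order b.test v
      rw [← hab']
      exact lt_sum_opposite_glueIndex a.test_mem hρ hne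
    · intro ρ hρ hne
      exact lt_sum_opposite_glueIndex (hV := hV) (h := b.subset) b.test_mem hρ hne
  obtain ⟨σ, θ, β, h1, h2, h3, h4⟩ := a
  obtain ⟨σ', θ', β', h1', h2', h3', h4'⟩ := b
  dsimp only at hface hab'
  subst hface
  have hβ : β = β' := by
    funext v
    rw [← glueIndex_of_mem (hV := hV) (h := h1) (θ := θ) (β := β) v, hab', glueIndex_of_mem]
  have hθ : θ = θ' := by
    funext i
    rw [← glueIndex_opposite (hV := hV) (h := h1) (θ := θ) (β := β) i, hab', glueIndex_opposite]
  subst hβ hθ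
  rfl

end Counting

/-! ### Unisolvence by comparing dimensions. -/

section Unisolvence
variable {d : ℕ} {V : Finset (Space d)} {r : ℕ → ℕ} {k : ℕ}

instance finite_multiIndex (k : ℕ) : Finite {α : V → ℕ // ∑ v, α v = k} := by
  classical
  refine Set.Finite.to_subtype (Set.Finite.subset (Finset.piAntidiag Finset.univ k).finite_toSet ?_)
  intro α hα
  exact Finset.mem_coe.2 (Finset.mem_piAntidiag.2 ⟨hα, fun _ _ => Finset.mem_univ _⟩)

/-- The homogeneous polynomial with given coefficients. -/
noncomputable def polyOfCoeffs (V : Finset (Space d)) (k : ℕ) :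
    ({α : V → ℕ // ∑ v, α v = k} →₀ ℝ) →ₗ[ℝ] MvPolynomial V ℝ :=
  Finsupp.linearCombination ℝ fun α =>
    MvPolynomial.monomial (Finsupp.equivFunOnFinite.symm α.1) (1 : ℝ)

lemma polyOfCoeffs_isHomogeneous (c : {α : V → ℕ // ∑ v, α v = k} →₀ ℝ) :
    (polyOfCoeffs V k c).IsHomogeneous k := by
  rw [polyOfCoeffs, Finsupp.linearCombination_apply]
  refine MvPolynomial.IsHomogeneous.sum _ _ _ fun α _ => ?_
  dsimp only
  rw [MvPolynomial.smul_monomial]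
  refine MvPolynomial.isHomogeneous_monomial _ ?_
  rw [Finsupp.degree_eq_sum]
  exact α.2

lemma polyOfCoeffs_injective : Function.Injective (polyOfCoeffs V k) := by
  have h : LinearIndependent ℝ fun α : {α : V → ℕ // ∑ v, α v = k} =>
      MvPolynomial.monomial (R := ℝ) (Finsupp.equivFunOnFinite.symm α.1) (1 : ℝ) := by
    refine (MvPolynomial.basisMonomials V ℝ).linearIndependent.comp
      (fun α : {α : V → ℕ // ∑ v, α v = k} => Finsupp.equivFunOnFinite.symm α.1) ?_
    exact fun a b hab => Subtype.ext (Finsupp.equivFunOnFinite.symm.injective hab)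
  exact h

/-- The degree of freedom as a linear functional on polynomials in barycentric coordinates. -/
noncomputable def dofFunctional (hV : IsTopSimplex V)
    (n : (σ : Finset (Space d)) → Fin (codim σ) → Space d) (a : DofIndex V r k) :
    MvPolynomial V ℝ →ₗ[ℝ] ℝ where
  toFun p := dof a.face (n a.face) a.order (baryMonomial a.face a.test)
    (baryPoly (simplexBasis hV) p)
  map_add' p q := by
    rw [dof_baryPoly hV a.subset a.nonempty, dof_baryPoly hV a.subset a.nonempty,
      dof_baryPoly hV a.subset a.nonempty, wordDeriv_add, add_mul, map_add]
  map_smul' c p := by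
    rw [dof_baryPoly hV a.subset a.nonempty, dof_baryPoly hV a.subset a.nonempty,
      wordDeriv_smul, smul_mul_assoc, map_smul, RingHom.id_apply]

lemma dofFunctional_apply (hV : IsTopSimplex V)
    (n : (σ : Finset (Space d)) → Fin (codim σ) → Space d) (a : DofIndex V r k)
    (p : MvPolynomial V ℝ) : dofFunctional hV n a p =
      dof a.face (n a.face) a.order (baryMonomial a.face a.test)
        (baryPoly (simplexBasis hV) p) := rfl

lemma eq_zero_of_dofFunctional (hr : Admissible d r k) (hV : IsTopSimplex V)
    {n : (σ : Finset (Space d)) → Fin (codim σ) → Space d}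
    (hn : ∀ σ ⊆ V, σ.Nonempty → IsNormalFrame σ (n σ)) {p : MvPolynomial V ℝ}
    (hp : p.IsHomogeneous k) (h : ∀ a : DofIndex V r k, dofFunctional hV n a p = 0) : p = 0 := by
  have hne : V.Nonempty := Finset.card_pos.1 (by rw [hV.1]; omega)
  have hmem := mem_vanishOrder_of_dof_eq_zero hr hV subset_rfl hn hp
    (fun σ hσ hσne θ hθ β hβ => h ⟨σ, θ, β, hσ, hσne, hθ, hβ⟩) V.card V subset_rfl hne rfl
  ext α
  have h0 : oppositeVertices V V = ∅ := by
    ext v; simp [mem_oppositeVertices]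
  exact hmem α (by rw [h0]; simp)

/-- The map from coefficients to degrees of freedom is injective by determination, and the target is
no larger by counting, so it is onto. -/
lemma exists_dofFunctional_eq (hr : Admissible d r k) (hV : IsTopSimplex V)
    {n : (σ : Finset (Space d)) → Fin (codim σ) → Space d}
    (hn : ∀ σ ⊆ V, σ.Nonempty → IsNormalFrame σ (n σ)) (c : DofIndex V r k → ℝ) :
    ∃ p : MvPolynomial V ℝ, p.IsHomogeneous k ∧ ∀ a, dofFunctional hV n a p = c a := by
  classical
  have hinj := DofIndex.toIndex_injective (V := V) hr hV
  have : Finite (DofIndex V r k) := Finite.of_injective _ hinj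
  have := Fintype.ofFinite (DofIndex V r k)
  have := Fintype.ofFinite {α : V → ℕ // ∑ v, α v = k}
  set A : ({α : V → ℕ // ∑ v, α v = k} →₀ ℝ) →ₗ[ℝ] (DofIndex V r k → ℝ) :=
    LinearMap.pi (fun a => dofFunctional hV n a) ∘ₗ polyOfCoeffs V k with hA
  have hAinj : Function.Injective A := by
    rw [← LinearMap.ker_eq_bot, LinearMap.ker_eq_bot']
    intro x hx
    refine polyOfCoeffs_injective ?_
    rw [map_zero]
    exact eq_zero_of_dofFunctional hr hV hn (polyOfCoeffs_isHomogeneous x) fun a => congrFun hx a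
  have hfin : Module.finrank ℝ ({α : V → ℕ // ∑ v, α v = k} →₀ ℝ) =
      Module.finrank ℝ (DofIndex V r k → ℝ) := by
    refine le_antisymm (LinearMap.finrank_le_finrank_of_injective hAinj) ?_
    rw [Module.finrank_fintype_fun_eq_card, Module.finrank_finsupp_self]
    exact Fintype.card_le_of_injective _ hinj
  obtain ⟨x, hx⟩ := (LinearMap.injective_iff_surjective_of_finrank_eq_finrank hfin).1 hAinj c
  exact ⟨polyOfCoeffs V k x, polyOfCoeffs_isHomogeneous x, fun a => congrFun hx a⟩

lemma existsUnique_of_dof_monomials (hr : Admissible d r k) (hV : IsTopSimplex V)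
    {n : (σ : Finset (Space d)) → Fin (codim σ) → Space d}
    (hn : ∀ σ ⊆ V, σ.Nonempty → IsNormalFrame σ (n σ))
    (c : (σ : Finset (Space d)) → (Fin (codim σ) → ℕ) → (σ → ℕ) → ℝ) :
    ∃! u : Space d → ℝ, u ∈ polySpace d k ∧
      ∀ σ ⊆ V, σ.Nonempty → ∀ θ ∈ orders r σ, ∀ β ∈ testIndices r k σ θ,
        dof σ (n σ) θ (baryMonomial σ β) u = c σ θ β := by
  obtain ⟨p, hp, hpc⟩ := exists_dofFunctional_eq hr hV hn
    (fun a : DofIndex V r k => c a.face a.order a.test)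
  refine ⟨baryPoly (simplexBasis hV) p, ⟨baryPoly_mem_polySpace hV hp,
    fun σ hσ hne θ hθ β hβ => hpc ⟨σ, θ, β, hσ, hne, hθ, hβ⟩⟩, ?_⟩
  rintro u ⟨hu, huc⟩
  obtain ⟨q, hq, rfl⟩ := exists_baryPoly_of_mem_polySpace hV hu
  have : q - p = 0 := eq_zero_of_dofFunctional hr hV hn (hq.sub hp) fun a => by
    rw [map_sub, hpc, dofFunctional_apply,
      huc _ a.subset a.nonempty _ a.order_mem _ a.test_mem, sub_self]
  rw [sub_eq_zero.1 this]

lemma dof_eq_of_mem_testSpace (hV : IsTopSimplex V) {σ : Finset (Space d)} (h : σ ⊆ V)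
    (hne : σ.Nonempty) (n : Fin (codim σ) → Space d) (θ : Fin (codim σ) → ℕ)
    (P : MvPolynomial V ℝ) (c : Module.Dual ℝ (Space d → ℝ))
    (hc : ∀ β ∈ testIndices r k σ θ,
      dof σ n θ (baryMonomial σ β) (baryPoly (simplexBasis hV) P) = c (baryMonomial σ β))
    {p : Space d → ℝ} (hp : p ∈ testSpace r k σ θ) :
    dof σ n θ p (baryPoly (simplexBasis hV) P) = c p := by
  -- Integrability is carried through the span induction because additivity of the integral needs
  -- it.
  suffices H : IntegrableOn (fun x => iterDirDeriv n θ (baryPoly (simplexBasis hV) P) x * p x)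
      (convexHull ℝ (σ : Set (Space d))) μHE[σ.card - 1] ∧
      dof σ n θ p (baryPoly (simplexBasis hV) P) = c p from H.2
  have hms := (isCompact_hull σ).measurableSet
  induction hp using Submodule.span_induction with
  | mem p hp =>
    obtain ⟨β, hβ, rfl⟩ := hp
    refine ⟨?_, hc β hβ⟩
    refine (integrableOn_hull (face_indep hV h) hne (baryPoly_contDiff (simplexBasis hV)
      (wordDeriv (simplexBasis hV) n (thetaWord θ) P *
        MvPolynomial.monomial (extendIndex V β) 1)).continuous).congr_fun (fun x hx => ?_) hms
    rw [iterDirDeriv_baryPoly, baryPoly_mul, baryMonomial_eq_baryPoly hV h hx]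
  | zero => exact ⟨by simp, by simp [dof]⟩
  | add p q _ _ hp hq =>
    refine ⟨by simpa [mul_add] using! hp.1.add hq.1, ?_⟩
    rw [map_add, ← hp.2, ← hq.2]
    simp only [dof, setAverage_eq, Pi.add_apply, mul_add]
    rw [integral_add hp.1 hq.1, smul_add]
  | smul a p _ hp =>
    refine ⟨by simpa [mul_left_comm] using! hp.1.const_mul a, ?_⟩
    rw [map_smul, ← hp.2]
    simp only [dof, setAverage_eq, Pi.smul_apply, smul_eq_mul, mul_left_comm _ a,
      integral_const_mul]

/-- The degrees of freedom are unisolvent. -/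
theorem unisolvent (hr : Admissible d r k) (hV : IsTopSimplex V)
    {n : (σ : Finset (Space d)) → Fin (codim σ) → Space d}
    (hn : ∀ σ ⊆ V, σ.Nonempty → IsNormalFrame σ (n σ)) : Unisolvent r k V n := by
  refine ⟨existsUnique_of_dof_monomials hr hV hn, fun c => ?_⟩
  obtain ⟨u, ⟨hu, huc⟩, huniq⟩ := existsUnique_of_dof_monomials hr hV hn
    (fun σ θ β => c σ θ (baryMonomial σ β))
  refine ⟨u, ⟨hu, fun σ hσ hne θ hθ p hp => ?_⟩, fun u' hu' => huniq u' ⟨hu'.1,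
    fun σ hσ hne θ hθ β hβ => hu'.2 σ hσ hne θ hθ _ (Submodule.subset_span ⟨β, hβ, rfl⟩)⟩⟩
  obtain ⟨P, _, rfl⟩ := exists_baryPoly_of_mem_polySpace hV hu
  exact dof_eq_of_mem_testSpace hV hσ hne _ _ P (c σ θ) (huc σ hσ hne θ hθ) hp

end Unisolvence

/-! ### Gluing the pieces across the mesh. -/

section Smoothness
variable {d : ℕ} {r : ℕ → ℕ} {k : ℕ}

lemma hasFDerivWithinAt_biUnion {E F ι : Type*} [NormedAddCommGroup E] [NormedSpace ℝ E]
    [NormedAddCommGroup F] [NormedSpace ℝ F] {S : Set ι} (hS : S.Finite) {t : ι → Set E} {f : E → F}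
    {f' : E →L[ℝ] F} {x : E} (h : ∀ i ∈ S, HasFDerivWithinAt f f' (t i) x) :
    HasFDerivWithinAt f f' (⋃ i ∈ S, t i) x := by
  induction S, hS using Set.Finite.induction_on with
  | empty => simp
  | insert _ _ ih =>
    rw [Set.biUnion_insert]
    exact (h _ (Set.mem_insert _ _)).union (ih fun i hi => h i (Set.mem_insert_of_mem _ hi))

lemma continuousOn_biUnion_of_isClosed {E F ι : Type*} [TopologicalSpace E] [TopologicalSpace F]
    {S : Set ι} (hS : S.Finite) {t : ι → Set E} {f : E → F} (ht : ∀ i ∈ S, IsClosed (t i))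
    (h : ∀ i ∈ S, ContinuousOn f (t i)) : ContinuousOn f (⋃ i ∈ S, t i) := by
  induction S, hS using Set.Finite.induction_on with
  | empty => simp
  | insert _ hS ih =>
    rw [Set.biUnion_insert]
    refine (h _ (Set.mem_insert _ _)).union_of_isClosed
      (ih (fun i hi => ht i (Set.mem_insert_of_mem _ hi))
        fun i hi => h i (Set.mem_insert_of_mem _ hi)) (ht _ (Set.mem_insert _ _))
      (hS.isClosed_biUnion fun i hi => ht i (Set.mem_insert_of_mem _ hi))

lemma contDiff_of_mem_polySpace {u : Space d → ℝ} (hu : u ∈ polySpace d k) : ContDiff ℝ ⊤ u := by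
  obtain ⟨P, -, rfl⟩ := hu
  induction P using MvPolynomial.induction_on with
  | C c =>
    have : polyFun d (MvPolynomial.C c) = fun _ => c := by funext x; simp [polyFun_apply]
    rw [this]; exact contDiff_const
  | add p q hp hq => rw [map_add]; exact hp.add hq
  | mul_X p i hp =>
    have : polyFun d (p * MvPolynomial.X i) = fun x => polyFun d p x * x i := by
      funext x; simp [polyFun_apply]
    rw [this]; exact hp.mul (contDiff_euclidean.1 contDiff_id i)

lemma isTopSimplex_of_mem_elements {T : Geometry.SimplicialComplex ℝ (Space d)}
    {K : Finset (Space d)} (hK : K ∈ elements T) : IsTopSimplex K :=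
  ⟨hK.2, T.indep hK.1⟩

/-- Polynomials on two simplices with the same degrees of freedom on the common face have the same
derivatives there. -/
lemma iteratedFDeriv_eq_of_dof_eq (hr : Admissible d r k) {K : Finset (Space d)}
    (hK : IsTopSimplex K) {σ : Finset (Space d)} (hσK : σ ⊆ K) (hσne : σ.Nonempty)
    {n : (σ : Finset (Space d)) → Fin (codim σ) → Space d}
    (hn : ∀ τ ⊆ σ, τ.Nonempty → IsNormalFrame τ (n τ)) {u v : Space d → ℝ}
    (hu : u ∈ polySpace d k) (hv : v ∈ polySpace d k)
    (h : ∀ τ ⊆ σ, τ.Nonempty → ∀ θ ∈ orders r τ, ∀ p ∈ testSpace r k τ θ,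
      dof τ (n τ) θ p u = dof τ (n τ) θ p v)
    {x : Space d} (hx : x ∈ convexHull ℝ (σ : Set (Space d))) {j : ℕ} (hj : j ≤ r (codim σ)) :
    iteratedFDeriv ℝ j u x = iteratedFDeriv ℝ j v x := by
  obtain ⟨p, hp, rfl⟩ := exists_baryPoly_of_mem_polySpace hK hu
  obtain ⟨q, hq, rfl⟩ := exists_baryPoly_of_mem_polySpace hK hv
  have hmem := mem_vanishOrder_of_dof_eq_zero hr hK hσK hn (hp.sub hq)
    (fun τ hτ hτne θ hθ β hβ => by
      have h1 := h τ hτ hτne θ hθ _ (Submodule.subset_span ⟨β, hβ, rfl⟩)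
      -- Both polynomials are written in the coordinates of the same simplex, so their difference is
      -- a form whose degrees of freedom on the subfaces of σ vanish.
      have h2 := map_sub (dofFunctional hK n ⟨τ, θ, β, hτ.trans hσK, hτne, hθ, hβ⟩) p q
      simp only [dofFunctional_apply] at h2
      rw [h2, h1, sub_self]) σ.card σ subset_rfl hσne rfl
  have h0 := iteratedFDeriv_baryPoly_eq_zero (simplexBasis hK) (x := x)
    (fun i hi => coord_eq_zero_of_mem_hull hK hσK hx (mem_oppositeVertices.1 hi)) j _
    (vanishOrder_anti (by omega) hmem)
  have hc : ∀ p : MvPolynomial K ℝ, ContDiff ℝ j (baryPoly (simplexBasis hK) p) := fun p =>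
    (baryPoly_contDiff (simplexBasis hK) p).of_le le_top
  rw [map_sub, iteratedFDeriv_sub (hc p) (hc q), Pi.sub_apply] at h0
  exact sub_eq_zero.1 h0

/-- Conformity puts x on the common face K ∩ K'. For distinct elements its codimension is at least
one, so its order of agreement is at least `r 1`. -/
lemma iteratedFDeriv_eq_of_mem_inter (hr : Admissible d r k)
    {T : Geometry.SimplicialComplex ℝ (Space d)}
    {n : (σ : Finset (Space d)) → Fin (codim σ) → Space d}
    (hn : ∀ σ ∈ T.faces, IsNormalFrame σ (n σ)) {U : Finset (Space d) → Space d → ℝ}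
    (hU : ∀ K ∈ elements T, U K ∈ polySpace d k)
    (h : ∀ K ∈ elements T, ∀ K' ∈ elements T, ∀ σ, σ ⊆ K → σ ⊆ K' → σ.Nonempty → σ.card ≤ d →
      ∀ θ ∈ orders r σ, ∀ p ∈ testSpace r k σ θ,
        dof σ (n σ) θ p (U K) = dof σ (n σ) θ p (U K'))
    {K K' : Finset (Space d)} (hK : K ∈ elements T) (hK' : K' ∈ elements T) {x : Space d}
    (hx : x ∈ convexHull ℝ (K : Set (Space d))) (hx' : x ∈ convexHull ℝ (K' : Set (Space d)))
    {j : ℕ} (hj : j ≤ r 1) :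
    iteratedFDeriv ℝ j (U K) x = iteratedFDeriv ℝ j (U K') x := by
  classical
  by_cases hKK : K = K'
  · rw [hKK]
  have hxσ : x ∈ convexHull ℝ ((K ∩ K' : Finset (Space d)) : Set (Space d)) := by
    rw [Finset.coe_inter]
    exact T.inter_subset_convexHull hK.1 hK'.1 ⟨hx, hx'⟩
  have hne : (K ∩ K').Nonempty := by
    rw [← Finset.coe_nonempty]
    exact convexHull_nonempty_iff.1 ⟨x, hxσ⟩
  have hcard : (K ∩ K').card < d + 1 := by
    rw [← hK.2]
    refine Finset.card_lt_card (Finset.inter_subset_left.ssubset_of_ne fun hc => hKK ?_)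
    exact Finset.eq_of_subset_of_card_le (Finset.inter_eq_left.1 hc) (by rw [hK.2, hK'.2])
  have hpos := hne.card_pos
  have hr1 : r 1 ≤ r (codim (K ∩ K')) :=
    hr.mono le_rfl (by rw [codim]; omega) (by rw [codim]; omega)
  refine iteratedFDeriv_eq_of_dof_eq (n := n) hr (isTopSimplex_of_mem_elements hK)
    Finset.inter_subset_left hne (fun τ hτ hτne => hn τ ?_) (hU K hK) (hU K' hK')
    (fun τ hτ hτne => h K hK K' hK' τ (hτ.trans Finset.inter_subset_left)
      (hτ.trans Finset.inter_subset_right) hτne ?_) hxσ (hj.trans hr1)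
  · exact T.down_closed hK.1 (hτ.trans Finset.inter_subset_left) hτne
  · have := Finset.card_le_card hτ
    omega

lemma closure_eq_biUnion_elements {T : Geometry.SimplicialComplex ℝ (Space d)} {Ω : Set (Space d)}
    (hT : IsMesh T Ω) : closure Ω = ⋃ K ∈ elements T, convexHull ℝ (K : Set (Space d)) := by
  rw [← hT.covers]
  ext x
  rw [Geometry.SimplicialComplex.mem_space_iff, Set.mem_iUnion₂]
  constructor
  · rintro ⟨σ, hσ, hx⟩
    obtain ⟨K, hK, hc, hσK⟩ := hT.pure σ hσ
    exact ⟨K, ⟨hK, hc⟩, convexHull_mono (Finset.coe_subset.2 hσK) hx⟩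
  · rintro ⟨K, hK, hx⟩
    exact ⟨K, hK.1, hx⟩

/-- A function given piecewise on finitely many closed sets by smooth functions whose derivatives
agree on the overlaps is smooth up to the boundary. -/
lemma mem_smoothSpace_of_piecewise {ι : Type*} {S : Set ι} (hS : S.Finite)
    {t : ι → Set (Space d)} (ht : ∀ i ∈ S, IsClosed (t i)) {Ω : Set (Space d)} (hΩ : IsOpen Ω)
    (hcover : closure Ω = ⋃ i ∈ S, t i) {ρ : ℕ} {U : ι → Space d → ℝ}
    (hU : ∀ i ∈ S, ContDiff ℝ ρ (U i))
    (hagree : ∀ i ∈ S, ∀ i' ∈ S, ∀ x ∈ t i, x ∈ t i' → ∀ j ≤ ρ,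
      iteratedFDeriv ℝ j (U i) x = iteratedFDeriv ℝ j (U i') x)
    {f : Space d → ℝ} (hf : ∀ i ∈ S, Set.EqOn f (U i) (t i ∩ Ω)) : f ∈ smoothSpace ρ Ω := by
  classical
  -- The candidate Taylor series of f comes from any piece containing x; agreement on overlaps makes
  -- the choice irrelevant up to order ρ.
  set G : Space d → FormalMultilinearSeries ℝ (Space d) ℝ := fun x =>
    if h : ∃ i ∈ S, x ∈ t i then ftaylorSeries ℝ (U h.choose) x else 0 with hGdef
  have hG : ∀ i ∈ S, ∀ x ∈ t i, ∀ j ≤ ρ, G x j = iteratedFDeriv ℝ j (U i) x := by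
    intro i hi x hx j hj
    have hex : ∃ i ∈ S, x ∈ t i := ⟨i, hi, hx⟩
    rw [hGdef]
    simp only [dif_pos hex]
    exact hagree _ hex.choose_spec.1 i hi x hex.choose_spec.2 hx j hj
  have hGc : ∀ j ≤ ρ, ContinuousOn (fun x => G x j) (closure Ω) := by
    intro j hj
    rw [hcover]
    refine continuousOn_biUnion_of_isClosed hS ht fun i hi => ?_
    exact ((hU i hi).continuous_iteratedFDeriv (by exact_mod_cast hj)).continuousOn.congr
      fun x hx => hG i hi x hx j hj
  have hT : HasFTaylorSeriesUpToOn ρ f G Ω := by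
    refine ⟨fun x hx => ?_, fun m hm x hx => ?_, fun m hm => ?_⟩
    · have hx' := subset_closure hx
      rw [hcover, Set.mem_iUnion₂] at hx'
      obtain ⟨i, hi, hxi⟩ := hx'
      rw [hG i hi x hxi 0 (Nat.zero_le _), hf i hi ⟨hxi, hx⟩]
      rfl
    · have hm' : m < ρ := by exact_mod_cast hm
      -- Differentiability is checked within the closure, a finite union of closed pieces, one piece
      -- at a time; a piece not containing x imposes nothing.
      refine HasFDerivWithinAt.mono ?_ subset_closure
      rw [hcover]
      refine hasFDerivWithinAt_biUnion hS fun i hi => ?_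
      by_cases hxi : x ∈ t i
      · have h1 := (contDiff_iff_ftaylorSeries (n := (ρ : ℕ∞)).1 (hU i hi)).fderiv m hm x
        rw [hG i hi x hxi (m + 1) hm']
        exact h1.hasFDerivWithinAt.congr (fun y hy => hG i hi y hy m hm'.le)
          (hG i hi x hxi m hm'.le)
      · exact HasFDerivWithinAt.of_notMem_closure (by rwa [(ht i hi).closure_eq])
    · exact (hGc m (by exact_mod_cast hm)).mono subset_closure
  refine ⟨hT.contDiffOn (n := (ρ : ℕ∞)), fun j hj => ⟨fun x => G x j, hGc j hj, fun x hx => ?_⟩⟩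
  rw [← iteratedFDerivWithin_of_isOpen j hΩ hx]
  exact hT.eq_iteratedFDerivWithin_of_uniqueDiffOn (by exact_mod_cast hj) hΩ.uniqueDiffOn hx

theorem feSpace_subset_smoothSpace (hr : Admissible d r k) {Ω : Set (Space d)}
    {T : Geometry.SimplicialComplex ℝ (Space d)}
    {n : (σ : Finset (Space d)) → Fin (codim σ) → Space d} (hT : IsMesh T Ω)
    (hn : ∀ σ ∈ T.faces, IsNormalFrame σ (n σ)) : feSpace r k T Ω n ⊆ smoothSpace (r 1) Ω := by
  rintro f ⟨-, U, hU, h⟩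
  exact mem_smoothSpace_of_piecewise (hT.finite.subset fun K hK => hK.1)
    (fun K _ => (isCompact_hull K).isClosed) hT.isOpen (closure_eq_biUnion_elements hT)
    (fun K hK => (contDiff_of_mem_polySpace (hU K hK).1).of_le le_top)
    (fun K hK K' hK' x hx hx' j hj => iteratedFDeriv_eq_of_mem_inter hr hn
      (fun K hK => (hU K hK).1) h hK hK' hx hx' hj) fun K hK => (hU K hK).2

theorem isConformingElement (hr : Admissible d r k) :
    IsConformingElement d r k (r 1) :=
  ⟨fun _ _ hV hn => unisolvent hr hV hn, fun _ _ _ hT hn => feSpace_subset_smoothSpace hr hT hn⟩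

/-- The doubling conditions hold with equality, and 2 r_d + 1 is exactly the bound on k. -/
lemma admissible_two_pow (hd : 1 ≤ d) {ρ : ℕ} (hk : 2 ^ d * ρ + 1 ≤ k) :
    Admissible d (fun i => 2 ^ (i - 1) * ρ) k := by
  refine ⟨fun i hi _ => ?_, ?_⟩
  · obtain ⟨i, rfl⟩ := Nat.exists_eq_add_of_le' hi
    simp only [Nat.add_sub_cancel, pow_succ]
    exact le_of_eq (by ring)
  · obtain ⟨d, rfl⟩ := Nat.exists_eq_add_of_le' hd
    simp only [Nat.add_sub_cancel]
    rw [pow_succ] at hk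
    linarith

end Smoothness

end SmoothFE

theorem theorem2p1 (d : ℕ) (hd : 1 ≤ d) :
    (∀ (r : ℕ → ℕ) (k : ℕ), SmoothFE.Admissible d r k →
      SmoothFE.IsConformingElement d r k (r 1)) ∧
    (∀ ρ k : ℕ, 2 ^ d * ρ + 1 ≤ k →
      SmoothFE.IsConformingElement d (fun i => 2 ^ (i - 1) * ρ) k ρ) := by
  refine ⟨fun r k hr => SmoothFE.isConformingElement hr, fun ρ k hk => ?_⟩
  have h := SmoothFE.isConformingElement (SmoothFE.admissible_two_pow hd hk)
  simpa using h
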